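/- Let $\beta>2$, let $\tilde L$ be a slowly varying function (that is, $\tilde L$ is measurable, positive near infinity, and $\tilde L(ax)/\tilde L(x)\to1$ as $x\to\infty$ for every $a>0$), and let $(p_i)_{i\ge0}$ be a probability distribution on $\{0,1,2,\dots\}$ such that $p_i=\tilde L(i)\,i^{-\beta}$ for all $i\ge1$ and whose mean $\kappa=\sum_{i\ge0} i\,p_i$ satisfies $\kappa<1$. Let $N^{(0)}$ be the number of leaves (vertices without children) in a Galton–Watson tree with offspring distribution $(p_i)_{i\ge0}$. Then, as $n\to\infty$, $$\mathbb P\bigl(N^{(0)}=n\bigr)\sim c\,\tilde L(n)\,n^{-\beta},\qquad\text{where } c=p_0^{\beta-1}(1-\kappa)^{-\beta}.$$ Here $a_n\sim b_n$ means $a_n/b_n\to1$. -/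

import Mathlib

/-- A slowly varying function (at infinity): a measurable function, positive on some
neighbourhood of `+∞`, such that `L (a x) / L x → 1` as `x → ∞` for every fixed `a > 0`. -/
structure IsSlowlyVarying (L : ℝ → ℝ) : Prop where
  measurable : Measurable L
  eventually_pos : ∀ᶠ x in Filter.atTop, 0 < L x
  tendsto_ratio : ∀ a : ℝ, 0 < a →
    Filter.Tendsto (fun x => L (a * x) / L x) Filter.atTop (nhds 1)

/-- Vertices of the Ulam-Harris tree are finite words `v = [v₁, …, vₖ]` of natural numbers (letters
start at `0`); the root is the empty word and the children of `v` are the words `v ++ [i]`.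
Given a family `k` of offspring numbers, `InTree k v` says that `v` belongs to the rooted planar
tree grown from the root in which every vertex `v` has exactly the children `v ++ [i]`, `i < k v`. -/
inductive InTree (k : List ℕ → ℕ) : List ℕ → Prop
  | root : InTree k []
  | child (v : List ℕ) (i : ℕ) : InTree k v → i < k v → InTree k (v ++ [i])

/-- The rooted planar tree (possibly infinite), as a set of vertices, with offspring numbers `k`.
When the offspring numbers are i.i.d. with law `p`, this is the Galton-Watson tree with offspring
distribution `p`. -/
def plantedTree (k : List ℕ → ℕ) : Set (List ℕ) := {v | InTree k v}

/-- The number of leaves of a rooted planar tree, i.e. of vertices without children,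
in `{0, 1, …, ∞}`. -/
noncomputable def numLeaves (T : Set (List ℕ)) : ℕ∞ :=
  {v | v ∈ T ∧ ∀ i : ℕ, v ++ [i] ∉ T}.encard

/-! Put `f n = P(N = n)` and `F = ∑ f n X^n`. Conditioning on the offspring number of the root gives
`F = p₀ X + F · G(F)` with `G = ∑ p_{i+1} X^i`. Solving for `X` turns this into `F = X · H(F)` with
`H = p₀ / (1 - G)`, and Lagrange inversion yields `(n+1) f_{n+1} = [X^n] H^(n+1)`. Since `G` has
mass `1 - p₀`, `H` is the law of a geometric sum, a genuine probability law, with mean `m = 1 -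
(1-κ)/p₀ < 1`. Counting leaves has become a local large deviation problem: a walk with `n+1`
nonnegative steps of mean `m` has to reach exactly `n`.

Two asymptotic facts finish the argument. By `PowerSeries.renewal_tendsto`, the coefficients satisfy
`h_n ~ g_n / p₀ = p_{n+1} / p₀`, so `H` inherits the regular variation of `p`. By
`PowerSeries.tendsto_coeff_pow_div`, the cheapest way for the walk to reach `n` is one step of size
about `(1-m) n`, the others behaving typically. Any of the `n+1` steps can be the large one, so
`[X^n] H^(n+1) ~ (n+1) (1-m)^(-β) h_n`. Hence `f_{n+1} ~ ((1-κ)/p₀)^(-β) p_{n+1} / p₀`, which is the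
stated constant.

The generating functions are formal power series over `ℝ` throughout; neither almost sure extinction
nor `∑ f n = 1` is needed. -/

open MeasureTheory ProbabilityTheory Filter Topology Finset

/-! ### Planted trees and the recursive structure of their leaves -/

theorem inTree_append_singleton_iff (k : List ℕ → ℕ) (v : List ℕ) (i : ℕ) :
    InTree k (v ++ [i]) ↔ InTree k v ∧ i < k v := by
  constructor
  · intro h
    generalize hw : v ++ [i] = w at h
    cases h with
    | root => simp at hw
    | child v' i' h1 h2 =>
      obtain ⟨rfl, h3⟩ := List.append_inj' hw rfl
      simp only [List.cons.injEq, and_true] at h3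
      subst h3
      exact ⟨h1, h2⟩
  · rintro ⟨h1, h2⟩
    exact InTree.child v i h1 h2

theorem inTree_cons_iff (k : List ℕ → ℕ) (j : ℕ) (v : List ℕ) :
    InTree k (j :: v) ↔ j < k [] ∧ InTree (fun w => k (j :: w)) v := by
  induction v using List.reverseRecOn with
  | nil =>
    have := inTree_append_singleton_iff k [] j
    simp only [List.nil_append] at this
    rw [this]
    exact ⟨fun h => ⟨h.2, InTree.root⟩, fun h => ⟨InTree.root, h.1⟩⟩
  | append_singleton v i ih =>
    rw [← List.cons_append, inTree_append_singleton_iff, inTree_append_singleton_iff, ih, and_assoc]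

/-- The vertices without children of the tree with offspring numbers `k`. -/
def leafSet (k : List ℕ → ℕ) : Set (List ℕ) := {v | InTree k v ∧ k v = 0}

/-- The number of leaves of the tree with offspring numbers `k`. -/
noncomputable def leafCount (k : List ℕ → ℕ) : ℕ∞ := numLeaves (plantedTree k)

theorem leafCount_eq (k : List ℕ → ℕ) : leafCount k = (leafSet k).encard := by
  unfold leafCount numLeaves leafSet plantedTree
  congr 1
  ext v
  simp only [Set.mem_ofPred_eq, inTree_append_singleton_iff]
  constructor
  · rintro ⟨h, h'⟩
    refine ⟨h, Nat.eq_zero_of_not_pos fun h0 => h' 0 ⟨h, h0⟩⟩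
  · rintro ⟨h, h'⟩
    exact ⟨h, fun i hi => by omega⟩

theorem leafCount_of_root_eq_zero (k : List ℕ → ℕ) (h : k [] = 0) : leafCount k = 1 := by
  rw [leafCount_eq, Set.encard_eq_one]
  refine ⟨[], Set.ext fun v => ?_⟩
  cases v with
  | nil => simp [leafSet, h, InTree.root]
  | cons j v => simp [leafSet, inTree_cons_iff, h]

theorem leafCount_of_root_ne_zero (k : List ℕ → ℕ) (h : k [] ≠ 0) :
    leafCount k = ∑ j ∈ range (k []), leafCount (fun w => k (j :: w)) := by
  have hset : leafSet k = ⋃ j ∈ (range (k []) : Set ℕ),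
      (List.cons j) '' leafSet (fun w => k (j :: w)) := by
    ext v
    cases v with
    | nil => simp [leafSet, h]
    | cons j v =>
      simp [leafSet, inTree_cons_iff, and_assoc, and_comm, and_left_comm]
  have hd : ((range (k []) : Set ℕ)).PairwiseDisjoint
      (fun j => (List.cons j) '' leafSet (fun w => k (j :: w))) := by
    intro i _ j _ hij
    refine Set.disjoint_left.2 ?_
    rintro _ ⟨v, _, rfl⟩ ⟨w, _, hw⟩
    simp only [List.cons.injEq] at hw
    exact hij hw.1.symm
  rw [leafCount_eq, hset, (Finset.finite_toSet _).encard_biUnion hd,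
    finsum_mem_coe_finset]
  refine Finset.sum_congr rfl fun j _ => ?_
  rw [leafCount_eq, (List.cons_injective).encard_image]

/-- There are countably many possible vertices, and whether a given one is a leaf depends on
finitely many offspring numbers. -/
theorem measurable_leafCount : Measurable leafCount := by
  have h1 : ∀ v : List ℕ, MeasurableSet {k : List ℕ → ℕ | InTree k v} := by
    intro v
    induction v using List.reverseRecOn with
    | nil => simp [InTree.root]
    | append_singleton v i ih =>
      simp only [inTree_append_singleton_iff]
      exact ih.inter ((measurable_pi_apply v) (measurableSet_Ioi (a := i)))
  have h2 : Measurable leafSet := by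
    refine measurable_set_iff.2 fun v => ?_
    exact ((h1 v).inter ((measurable_pi_apply v) (measurableSet_singleton 0))).mem
  have h3 : leafCount = fun k => (leafSet k).encard := funext leafCount_eq
  rw [h3]
  exact measurable_encard.comp h2

/-! ### The law of the number of leaves of a Galton–Watson tree -/

section GaltonWatson

variable {Ω : Type*} {mΩ : MeasurableSpace Ω} {P : Measure Ω}
  {p : ℕ → ℝ} {ξ : List ℕ → Ω → ℕ}

/-- The number of leaves of the subtree at the `j`-th child of the root. -/
noncomputable def childLeaves (ξ : List ℕ → Ω → ℕ) (j : ℕ) (ω : Ω) : ℕ∞ :=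
  leafCount (fun w => ξ (j :: w) ω)

theorem measurable_childLeaves_comap (ξ : List ℕ → Ω → ℕ) (S : Set (List ℕ)) (j : ℕ)
    (hS : ∀ w, j :: w ∈ S) :
    Measurable[⨆ v ∈ S, MeasurableSpace.comap (ξ v) inferInstance] (childLeaves ξ j) := by
  refine measurable_leafCount.comp ?_
  refine @measurable_pi_lambda _ _ _ (_) _ _ fun w => ?_
  exact (comap_measurable (ξ (j :: w))).mono
    (le_iSup₂_of_le (f := fun v (_ : v ∈ S) => MeasurableSpace.comap (ξ v) inferInstance)
      (j :: w) (hS w) le_rfl) le_rfl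

/-- All independence used below takes this form: the root against the rest, or subtrees hanging from
different children. -/
theorem indepFun_of_disjoint {α γ : Type*} [MeasurableSpace α] [MeasurableSpace γ]
    (hm : ∀ v, Measurable (ξ v)) (hi : iIndepFun ξ P)
    {S T : Set (List ℕ)} (hST : Disjoint S T) {f : Ω → α} {g : Ω → γ}
    (hf : Measurable[⨆ v ∈ S, MeasurableSpace.comap (ξ v) inferInstance] f)
    (hg : Measurable[⨆ v ∈ T, MeasurableSpace.comap (ξ v) inferInstance] g) :
    IndepFun f g P := by
  have := indep_iSup_of_disjoint (fun v => (hm v).comap_le) hi hST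
  rw [IndepFun_iff_Indep]
  exact indep_of_indep_of_le_left (indep_of_indep_of_le_right this hg.comap_le) hf.comap_le

theorem measurable_childLeaves (hm : ∀ v, Measurable (ξ v)) (j : ℕ) :
    Measurable (childLeaves ξ j) :=
  measurable_leafCount.comp (measurable_pi_lambda _ fun w => hm (j :: w))

/-- Relabelling by `w ↦ j :: w` is injective, so the shifted offspring family is again i.i.d.; both
families have the same infinite product law. -/
theorem map_childLeaves (hm : ∀ v, Measurable (ξ v)) (hi : iIndepFun ξ P)
    (hl : ∀ (v : List ℕ) (i : ℕ), P {ω | ξ v ω = i} = ENNReal.ofReal (p i)) (j : ℕ) (n : ℕ∞) :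
    P.real {ω | childLeaves ξ j ω = n} = P.real {ω | leafCount (fun v => ξ v ω) = n} := by
  have hlaw : ∀ v w, P.map (ξ v) = P.map (ξ w) := by
    intro v w
    refine Measure.ext_of_singleton fun i => ?_
    rw [Measure.map_apply (hm v) (measurableSet_singleton i),
      Measure.map_apply (hm w) (measurableSet_singleton i)]
    exact (hl v i).trans (hl w i).symm
  have h1 := hi.map_fun_eq_infinitePi_map hm
  have h2 := (hi.precomp (List.cons_injective (a := j))).map_fun_eq_infinitePi_map
    (fun v => hm (j :: v))
  have h3 : P.map (fun ω v => ξ v ω) = P.map (fun ω w => ξ (j :: w) ω) := by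
    rw [h1]
    refine Eq.trans ?_ h2.symm
    congr 1
    funext v
    exact hlaw _ _
  have hs : MeasurableSet {k : List ℕ → ℕ | leafCount k = n} :=
    measurable_leafCount (measurableSet_singleton n)
  have e1 := Measure.map_apply (μ := P) (measurable_pi_lambda _ fun w => hm w) hs
  have e2 := Measure.map_apply (μ := P) (measurable_pi_lambda _ fun w => hm (j :: w)) hs
  unfold Measure.real
  congr 1
  refine Eq.trans e2.symm (Eq.trans ?_ e1)
  rw [h3]


theorem measureReal_sum_childLeaves (hP : IsProbabilityMeasure P) (hm : ∀ v, Measurable (ξ v))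
    (hi : iIndepFun ξ P)
    (hl : ∀ (v : List ℕ) (i : ℕ), P {ω | ξ v ω = i} = ENNReal.ofReal (p i)) (i n : ℕ) :
    P.real {ω | ∑ j ∈ range i, childLeaves ξ j ω = n} = PowerSeries.coeff n
      ((PowerSeries.mk fun m : ℕ => P.real {ω | leafCount (fun v => ξ v ω) = m}) ^ i) := by
  induction i generalizing n with
  | zero =>
    simp only [range_zero, sum_empty, pow_zero, PowerSeries.coeff_one]
    by_cases h : n = 0
    · simp [h]
    · simp [h, eq_comm]
  | succ i ih =>
    have hS : Measurable[⨆ v ∈ {v : List ℕ | ∃ j w, j < i ∧ v = j :: w},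
        MeasurableSpace.comap (ξ v) inferInstance]
        (fun ω => ∑ j ∈ range i, childLeaves ξ j ω) := by
      refine Finset.measurable_sum _ fun j hj => ?_
      exact measurable_childLeaves_comap ξ _ j fun w => ⟨j, w, mem_range.1 hj, rfl⟩
    have hN := measurable_childLeaves_comap ξ {v : List ℕ | ∃ w, v = i :: w} i fun w => ⟨w, rfl⟩
    have hind := indepFun_of_disjoint hm hi (Set.disjoint_left.2 (by
      rintro _ ⟨j, w, hj, rfl⟩ ⟨w', hw⟩
      simp only [List.cons.injEq] at hw
      omega)) hS hN
    have hSm : Measurable (fun ω => ∑ j ∈ range i, childLeaves ξ j ω) :=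
      Finset.measurable_sum _ fun j _ => measurable_childLeaves hm j
    have hNm := measurable_childLeaves hm i
    have hset : {ω | ∑ j ∈ range (i + 1), childLeaves ξ j ω = (n : ℕ∞)} =
        ⋃ x ∈ antidiagonal n, ((fun ω => ∑ j ∈ range i, childLeaves ξ j ω) ⁻¹' {(x.1 : ℕ∞)} ∩
          childLeaves ξ i ⁻¹' {(x.2 : ℕ∞)}) := by
      ext ω
      simp only [sum_range_succ, Set.mem_ofPred_eq, Set.mem_iUnion, Set.mem_inter_iff,
        Set.mem_preimage, Set.mem_singleton_iff, HasAntidiagonal.mem_antidiagonal, exists_prop, Prod.exists]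
      constructor
      · intro h
        have h1 : (∑ j ∈ range i, childLeaves ξ j ω) ≠ ⊤ := by
          intro h'; rw [h'] at h; simp at h
        have h2 : childLeaves ξ i ω ≠ ⊤ := by
          intro h'; rw [h'] at h; simp at h
        obtain ⟨a, ha⟩ := ENat.ne_top_iff_exists.1 h1
        obtain ⟨b, hb⟩ := ENat.ne_top_iff_exists.1 h2
        refine ⟨a, b, ?_, ha.symm, hb.symm⟩
        rw [← ha, ← hb] at h
        exact_mod_cast h
      · rintro ⟨a, b, h, ha, hb⟩
        rw [ha, hb]
        exact_mod_cast h
    rw [hset, measureReal_biUnion_finset, pow_succ, PowerSeries.coeff_mul]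
    · refine Finset.sum_congr rfl fun x _ => ?_
      rw [measureReal_def, hind.measure_inter_preimage_eq_mul _ _ (measurableSet_singleton _)
        (measurableSet_singleton _), ENNReal.toReal_mul, ← ih, PowerSeries.coeff_mk,
        ← map_childLeaves hm hi hl i]
      rfl
    · intro x _ y _ hxy
      refine Set.disjoint_left.2 ?_
      rintro ω ⟨h1, h2⟩ ⟨h3, h4⟩
      simp only [Set.mem_preimage, Set.mem_singleton_iff] at h1 h2 h3 h4
      rw [h1] at h3
      rw [h2] at h4
      exact hxy (Prod.ext (by exact_mod_cast h3) (by exact_mod_cast h4))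
    · intro x _
      exact (hSm (measurableSet_singleton _)).inter (hNm (measurableSet_singleton _))

theorem measureReal_root_inter (hm : ∀ v, Measurable (ξ v)) (hi : iIndepFun ξ P)
    (hp : ∀ i, 0 ≤ p i)
    (hl : ∀ (v : List ℕ) (i : ℕ), P {ω | ξ v ω = i} = ENNReal.ofReal (p i)) (i : ℕ)
    (s : Set (ℕ → ℕ∞)) (hs : MeasurableSet s) :
    P.real ({ω | ξ [] ω = i} ∩ {ω | (fun j => childLeaves ξ j ω) ∈ s}) =
      p i * P.real {ω | (fun j => childLeaves ξ j ω) ∈ s} := by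
  have hS : Measurable[⨆ v ∈ {v : List ℕ | v ≠ []},
      MeasurableSpace.comap (ξ v) inferInstance] (fun ω j => childLeaves ξ j ω) := by
    refine @measurable_pi_lambda _ _ _ (_) _ _ fun j => ?_
    exact measurable_childLeaves_comap ξ _ j fun w => by simp
  have h0 : Measurable[⨆ v ∈ ({[]} : Set (List ℕ)),
      MeasurableSpace.comap (ξ v) inferInstance] (ξ []) := by
    exact (comap_measurable (ξ [])).mono (le_iSup₂_of_le
      (f := fun v (_ : v ∈ ({[]} : Set (List ℕ))) => MeasurableSpace.comap (ξ v) inferInstance)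
      [] rfl le_rfl) le_rfl
  have hind := indepFun_of_disjoint hm hi (Set.disjoint_left.2 (by
      rintro v rfl h
      exact h rfl)) h0 hS
  have := hind.measure_inter_preimage_eq_mul {i} s (measurableSet_singleton _) hs
  have h1 : P (ξ [] ⁻¹' {i}) = ENNReal.ofReal (p i) := hl [] i
  rw [h1] at this
  rw [measureReal_def, measureReal_def, ← ENNReal.toReal_ofReal (hp i), ← ENNReal.toReal_mul]
  exact congrArg ENNReal.toReal this

/-- Branching at the root: no child makes the root the only leaf, while `i ≥ 1` children contribute
the `i`-fold convolution of the law itself. These are the coefficients of the functional equation of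
the generating function. -/
theorem hasSum_measureReal_leafCount (hP : IsProbabilityMeasure P) (hm : ∀ v, Measurable (ξ v))
    (hi : iIndepFun ξ P) (hp : ∀ i, 0 ≤ p i)
    (hl : ∀ (v : List ℕ) (i : ℕ), P {ω | ξ v ω = i} = ENNReal.ofReal (p i)) (n : ℕ) :
    HasSum (fun i : ℕ => if i = 0 then (if n = 1 then p 0 else 0) else
      p i * PowerSeries.coeff n
        ((PowerSeries.mk fun m : ℕ => P.real {ω | leafCount (fun v => ξ v ω) = m}) ^ i))
      (P.real {ω | leafCount (fun v => ξ v ω) = n}) := by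
  have hN : Measurable fun ω => leafCount (fun v => ξ v ω) :=
    measurable_leafCount.comp (measurable_pi_lambda _ hm)
  set A : ℕ → Set Ω := fun i => {ω | ξ [] ω = i} ∩ {ω | leafCount (fun v => ξ v ω) = n} with hA
  have hAm : ∀ i, MeasurableSet (A i) := fun i =>
    (hm [] (measurableSet_singleton i)).inter (hN (measurableSet_singleton _))
  have hAd : Pairwise (Function.onFun Disjoint A) := by
    intro i j hij
    refine Set.disjoint_left.2 ?_
    rintro ω ⟨h1, _⟩ ⟨h2, _⟩
    exact hij (h1.symm.trans h2)
  have hU : {ω | leafCount (fun v => ξ v ω) = (n : ℕ∞)} = ⋃ i, A i := by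
    ext ω; simp [hA]
  have hsum : HasSum (fun i => P.real (A i)) (P.real (⋃ i, A i)) := by
    have h := measure_iUnion hAd hAm (μ := P)
    rw [measureReal_def, h, ENNReal.tsum_toReal_eq fun i => measure_ne_top _ _]
    exact ENNReal.hasSum_toReal (by rw [← h]; exact measure_ne_top _ _)
  rw [hU]
  convert hsum using 2 with i
  by_cases h0 : i = 0
  · subst h0
    have : A 0 = if n = 1 then {ω | ξ [] ω = 0} else ∅ := by
      ext ω
      simp only [hA, Set.mem_inter_iff, Set.mem_ofPred_eq]
      by_cases h1 : n = 1
      · simp only [h1, if_true, Set.mem_ofPred_eq, Nat.cast_one, and_iff_left_iff_imp]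
        exact fun h => leafCount_of_root_eq_zero _ h
      · simp only [h1, if_false, Set.mem_empty_iff_false, iff_false, not_and]
        intro h
        rw [leafCount_of_root_eq_zero _ h]
        exact fun h2 => h1 (by exact_mod_cast h2.symm)
    rw [this, if_pos rfl]
    by_cases h1 : n = 1
    · rw [if_pos h1, if_pos h1, measureReal_def, hl, ENNReal.toReal_ofReal (hp 0)]
    · simp [h1]
  · rw [if_neg h0, ← measureReal_sum_childLeaves hP hm hi hl]
    have hms : MeasurableSet {x : ℕ → ℕ∞ | ∑ j ∈ range i, x j = n} :=
      (Finset.measurable_sum _ fun j _ => measurable_pi_apply j) (measurableSet_singleton _)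
    refine (measureReal_root_inter hm hi hp hl i _ hms).symm.trans ?_
    congr 1
    ext ω
    simp only [hA, Set.mem_inter_iff, Set.mem_ofPred_eq, and_congr_right_iff]
    intro h
    rw [leafCount_of_root_ne_zero _ (by rw [h]; exact h0), h]
    rfl

/-- A leafless tree has a root with at least one child, and every child's subtree is leafless, so
the probability `f` satisfies `f ≤ (1 - p 0) * f`. Vanishing of `f` is what makes substitution into
formal power series legitimate. -/
theorem measureReal_leafCount_eq_zero (hP : IsProbabilityMeasure P) (hm : ∀ v, Measurable (ξ v))
    (hi : iIndepFun ξ P) (hp : ∀ i, 0 ≤ p i) (hp0 : 0 < p 0) (hp1 : HasSum p 1)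
    (hl : ∀ (v : List ℕ) (i : ℕ), P {ω | ξ v ω = i} = ENNReal.ofReal (p i)) :
    P.real {ω | leafCount (fun v => ξ v ω) = (0 : ℕ)} = 0 := by
  have h := hasSum_measureReal_leafCount hP hm hi hp hl 0
  set f := P.real {ω | leafCount (fun v => ξ v ω) = (0 : ℕ)} with hf
  have hf0 : 0 ≤ f := measureReal_nonneg
  have hf1 : f ≤ 1 := measureReal_le_one
  have h2 : HasSum (fun i => (if i = 0 then 0 else p i) * f) ((1 - p 0) * f) := by
    refine HasSum.mul_right f ?_
    have h3 : (fun i => if i = 0 then 0 else p i) = Function.update p 0 0 := by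
      funext i
      by_cases h : i = 0
      · subst h; simp
      · simp [h]
    rw [h3, show 1 - p 0 = 0 - p 0 + 1 by ring]
    exact hp1.update 0 0
  have h3 : f ≤ (1 - p 0) * f := by
    refine hasSum_le (fun i => ?_) h h2
    by_cases hi0 : i = 0
    · simp [hi0]
    · rw [if_neg hi0, if_neg hi0]
      refine mul_le_mul_of_nonneg_left ?_ (hp i)
      rw [PowerSeries.coeff_zero_eq_constantCoeff, map_pow,
        ← PowerSeries.coeff_zero_eq_constantCoeff_apply, PowerSeries.coeff_mk]
      exact pow_le_of_le_one hf0 hf1 hi0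
  nlinarith

end GaltonWatson

/-! ### Formal Lagrange inversion -/

namespace PowerSeries

theorem hasSubst_of_coeff_zero {F : ℝ⟦X⟧} (hF : constantCoeff F = 0) : HasSubst F :=
  HasSubst.of_constantCoeff_zero' hF

theorem coeff_pow_eq_zero_of_lt {F : ℝ⟦X⟧} (hF : constantCoeff F = 0) {n d : ℕ} (h : n < d) :
    coeff n (F ^ d) = 0 := by
  obtain ⟨H, rfl⟩ := X_dvd_iff.2 hF
  rw [mul_pow, coeff_X_pow_mul', if_neg (by omega)]

theorem coeff_subst_eq_sum {F : ℝ⟦X⟧} (hF : constantCoeff F = 0) (U : ℝ⟦X⟧) (n : ℕ) :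
    coeff n (U.subst F) = ∑ d ∈ range (n + 1), coeff d U * coeff n (F ^ d) := by
  rw [coeff_subst' (hasSubst_of_coeff_zero hF), finsum_eq_sum_of_support_subset]
  · rfl
  · intro d hd
    rw [Function.mem_support] at hd
    simp only [coe_range, Set.mem_Iio]
    by_contra h
    exact hd (by rw [coeff_pow_eq_zero_of_lt hF (by omega), smul_zero])

/-- Lagrange inversion for the powers of the solution of `F = X * H(F)`. -/
theorem lagrange_inversion_pow {F H : ℝ⟦X⟧} (hF : constantCoeff F = 0)
    (hFH : F = X * H.subst F) (n k : ℕ) :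
    (n : ℝ) * coeff n (F ^ k) = k * coeff n (X ^ k * H ^ n) := by
  induction n generalizing k with
  | zero =>
    rcases k with _ | k
    · simp
    · simp
  | succ n ih =>
    rcases k with _ | k
    · simp [coeff_one]
    have hsub := hasSubst_of_coeff_zero hF
    -- Peeling off one factor `X * H(F)` lowers the coefficient index from `n + 1` to `n`, where the
    -- induction hypothesis applies to every power `F ^ d`.
    have hpow : F ^ (k + 1) = X * (X ^ k * H).subst F := by
      rw [subst_mul hsub, subst_pow hsub, subst_X hsub, pow_succ]
      nth_rewrite 2 [hFH]
      ring
    rw [hpow, coeff_succ_X_mul, coeff_subst_eq_sum hF]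
    have hc : coeff (n + 1) (X ^ (k + 1) * H ^ (n + 1)) = coeff n (X ^ k * H ^ (n + 1)) := by
      rw [pow_succ' X, mul_assoc, coeff_succ_X_mul]
    rw [hc]
    rcases Nat.eq_zero_or_pos n with rfl | hn
    · rcases k with _ | k <;> simp
    set A := ∑ d ∈ range (n + 1), coeff d (X ^ k * H) * coeff n (F ^ d) with hA
    set c := coeff n (X ^ k * H ^ (n + 1)) with hcdef
    -- The induction hypothesis produces a weight `d` in front of the coefficient of degree `d`,
    -- which is the effect of `X * d/dX`.
    have h1 : (n : ℝ) * A = coeff n ((X * derivative ℝ (X ^ k * H)) * H ^ n) := by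
      rw [hA, mul_sum, coeff_mul, Finset.Nat.sum_antidiagonal_eq_sum_range_succ_mk]
      refine Finset.sum_congr rfl fun d hd => ?_
      have hd' : d ≤ n := by simpa [Nat.lt_succ_iff] using hd
      have e : (n : ℝ) * (coeff d (X ^ k * H) * coeff n (F ^ d)) =
        coeff d (X ^ k * H) * (d * coeff n (X ^ d * H ^ n)) := by
        rw [← ih d]; ring
      rw [e, coeff_X_pow_mul' (H ^ n) d n, if_pos hd']
      rcases d with _ | d
      · simp
      · rw [coeff_succ_X_mul, coeff_derivative]
        push_cast
        ring
    have hder : ∀ f g : ℝ⟦X⟧, derivative ℝ (f * g) = f * derivative ℝ g + derivative ℝ f * g := by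
      intro f g
      have := (derivative ℝ).leibniz f g
      simp only [smul_eq_mul] at this
      rw [this]; ring
    have hdp : derivative ℝ (H ^ (n + 1)) = (n + 1 : ℝ⟦X⟧) * H ^ n * derivative ℝ H := by
      rw [derivative_pow]
      simp
    have hdX : X * derivative ℝ (X ^ k : ℝ⟦X⟧) = (k : ℝ⟦X⟧) * X ^ k := by
      have h2 : derivative ℝ (X ^ k : ℝ⟦X⟧) = (k : ℝ⟦X⟧) * X ^ (k - 1) := by simp
      rw [h2]
      rcases k with _ | k
      · simp
      · simp only [Nat.add_sub_cancel]; ring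
    -- Coefficient `n` of the derivative of `X ^ (k + 1) * H ^ (n + 1)`, computed directly and by
    -- the product rule; with `h3` it eliminates the term containing the derivative of `H ^ (n +
    -- 1)`.
    have h2 : ((n : ℝ) + 1) * c = k * c + c + coeff n (X ^ (k + 1) * derivative ℝ (H ^ (n + 1))) := by
      have e1 : coeff n (derivative ℝ (X ^ (k + 1) * H ^ (n + 1))) = c * (n + 1) := by
        rw [coeff_derivative, hc]
      have e2 : derivative ℝ (X ^ (k + 1) * H ^ (n + 1)) =
          X ^ (k + 1) * derivative ℝ (H ^ (n + 1)) + (k + 1 : ℝ⟦X⟧) * (X ^ k * H ^ (n + 1)) := by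
        rw [hder]
        have h4 : derivative ℝ (X ^ (k + 1) : ℝ⟦X⟧) = (k + 1 : ℝ⟦X⟧) * X ^ k := by
          rw [derivative_pow]; simp
        rw [h4]; ring
      have e3 : coeff n ((k + 1 : ℝ⟦X⟧) * (X ^ k * H ^ (n + 1))) = (k + 1) * c := by
        rw [show (k + 1 : ℝ⟦X⟧) = C (k + 1 : ℝ) by simp, coeff_C_mul]
      rw [e2, map_add, e3] at e1
      linarith
    have h3 : ((n : ℝ) + 1) * ((n : ℝ) * A) = (n + 1) * (k * c) +
        coeff n (X ^ (k + 1) * derivative ℝ (H ^ (n + 1))) := by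
      have e1 : (n + 1 : ℝ⟦X⟧) * ((X * derivative ℝ (X ^ k * H)) * H ^ n) =
          C ((n + 1 : ℝ) * k) * (X ^ k * H ^ (n + 1)) +
            X ^ (k + 1) * derivative ℝ (H ^ (n + 1)) := by
        rw [hder, hdp, mul_add]
        have : X * (derivative ℝ (X ^ k : ℝ⟦X⟧) * H) = (k : ℝ⟦X⟧) * X ^ k * H := by
          rw [← hdX]; ring
        rw [this]
        simp only [map_mul, map_add, map_natCast, map_one]
        ring
      have e2 := congrArg (coeff n) e1
      rw [map_add, coeff_C_mul, show (n + 1 : ℝ⟦X⟧) = C (n + 1 : ℝ) by simp, coeff_C_mul,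
        ← h1] at e2
      rw [e2, mul_assoc]
    have hn' : (n : ℝ) ≠ 0 := by positivity
    have : (n : ℝ) * (((n : ℝ) + 1) * A) = n * (((k : ℝ) + 1) * c) := by linarith
    push_cast
    exact mul_left_cancel₀ hn' this

theorem lagrange_inversion {F H : ℝ⟦X⟧} (hF : constantCoeff F = 0)
    (hFH : F = X * H.subst F) (n : ℕ) :
    ((n : ℝ) + 1) * coeff (n + 1) F = coeff n (H ^ (n + 1)) := by
  have := lagrange_inversion_pow hF hFH (n + 1) 1
  simpa [coeff_succ_X_mul] using this

/-- If `F = c X + F G(F)` then `F = X H(F)` for any `H` with `H (1 - G) = c`. -/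
theorem eq_X_mul_subst {F G H : ℝ⟦X⟧} {c : ℝ} (hc : c ≠ 0) (hF : constantCoeff F = 0)
    (hG : F = C c * X + (X * G).subst F) (hH : H * (1 - G) = C c) : F = X * H.subst F := by
  have hsub := hasSubst_of_coeff_zero hF
  rw [subst_mul hsub, subst_X hsub] at hG
  have h1 : H.subst F * (1 - G.subst F) = C c := by
    have h2 := congrArg (fun U : ℝ⟦X⟧ => U.subst F) hH
    simp only [subst_mul hsub, subst_sub hsub] at h2
    have e1 : (1 : ℝ⟦X⟧).subst F = (1 : ℝ⟦X⟧) := by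
      rw [← coe_substAlgHom hsub, map_one]
    have e2 : (C c : ℝ⟦X⟧).subst F = (C c : ℝ⟦X⟧) := by
      exact subst_C c
    rwa [e1, e2] at h2
  have h3 : C c * F = C c * (X * H.subst F) := by
    linear_combination (H.subst F) * hG - F * h1
  have hc' : (C c : ℝ⟦X⟧) ≠ 0 := by simpa using hc
  exact mul_left_cancel₀ hc' h3

end PowerSeries

/-! ### Slowly varying functions and regularly varying sequences -/

/-- Uniform convergence theorem for slowly varying functions, additive form. -/
theorem tendsto_sub_of_bounded_shift {h : ℝ → ℝ} (hm : Measurable h)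
    (hh : ∀ u, Tendsto (fun x => h (x + u) - h x) atTop (𝓝 0)) {y t : ℕ → ℝ} {T : ℝ}
    (hy : Tendsto y atTop atTop) (ht : ∀ n, |t n| ≤ T) :
    Tendsto (fun n => h (y n + t n) - h (y n)) atTop (𝓝 0) := by
  have hkey : ∀ (z : ℕ → ℝ) (a b : ℝ), Tendsto z atTop atTop → ∀ ε : ℝ, 0 < ε →
      ∀ᶠ n in atTop, (volume.restrict (Set.Icc a b)) {s | ε ≤ ‖h (z n + s) - h (z n)‖} < 1 / 2 := by
    intro z a b hz ε hε
    have := tendstoInMeasure_of_tendsto_ae (μ := volume.restrict (Set.Icc a b))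
      (f := fun n s => h (z n + s) - h (z n)) (g := fun _ => (0 : ℝ))
      (fun n => ((hm.comp (measurable_const.add measurable_id)).sub_const _).aestronglyMeasurable)
      (ae_of_all _ fun s => (hh s).comp hz)
    have h2 := (tendstoInMeasure_iff_norm.1 this) ε hε
    simp only [sub_zero] at h2
    exact h2.eventually (gt_mem_nhds (by simp))
  have hyt : Tendsto (fun n => y n + t n) atTop atTop :=
    tendsto_atTop_add_right_of_le _ (-T) hy fun n => (abs_le.1 (ht n)).1
  rw [Metric.tendsto_atTop']
  intro ε hε
  obtain ⟨N, hN⟩ := eventually_atTop.1 ((hkey y (-T) (T + 1) hy (ε / 2) (half_pos hε)).and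
    (hkey _ 0 1 hyt (ε / 2) (half_pos hε)))
  refine ⟨N, fun n hn => ?_⟩
  obtain ⟨h1, h2⟩ := hN n hn.le
  set A := {s | ε / 2 ≤ ‖h (y n + s) - h (y n)‖} with hA
  set B := {s | ε / 2 ≤ ‖h (y n + t n + s) - h (y n + t n)‖} with hB
  have hAm : MeasurableSet A := measurableSet_le measurable_const
    ((hm.comp (measurable_const.add measurable_id)).sub_const _).norm
  have hBm : MeasurableSet B := measurableSet_le measurable_const
    ((hm.comp (measurable_const.add measurable_id)).sub_const _).norm
  rw [Measure.restrict_apply hAm] at h1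
  rw [Measure.restrict_apply hBm] at h2
  -- The bad sets around `y n` and `y n + t n` each have measure below `1 / 2` in the relevant
  -- window, so after translation they cannot cover an interval of length `1`. A good `s` compares
  -- both values with `h (y n + t n + s)`.
  have hex : ∃ s ∈ Set.Icc (0 : ℝ) 1, t n + s ∉ A ∧ s ∉ B := by
    by_contra hcon
    push Not at hcon
    have hsub : Set.Icc (0 : ℝ) 1 ⊆ ((fun s => t n + s) ⁻¹' (A ∩ Set.Icc (-T) (T + 1))) ∪
        (B ∩ Set.Icc 0 1) := by
      intro s hs
      by_cases hsA : t n + s ∈ A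
      · left
        have := abs_le.1 (ht n)
        exact ⟨hsA, by constructor <;> linarith [hs.1, hs.2, this.1, this.2]⟩
      · exact Or.inr ⟨hcon s hs hsA, hs⟩
    have h3 := (measure_mono hsub).trans (measure_union_le (μ := volume) _ _)
    rw [measure_preimage_add] at h3
    have h4 := h3.trans_lt (ENNReal.add_lt_add h1 h2)
    rw [ENNReal.add_halves] at h4
    simp at h4
  obtain ⟨s, _, hsA, hsB⟩ := hex
  simp only [hA, hB, Set.mem_ofPred_eq, not_le, Real.norm_eq_abs] at hsA hsB
  rw [← add_assoc] at hsA
  rw [Real.dist_eq, sub_zero]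
  have : h (y n + t n) - h (y n) = (h (y n + t n + s) - h (y n)) -
    (h (y n + t n + s) - h (y n + t n)) := by ring
  rw [this]
  calc _ ≤ _ := abs_sub _ _
    _ < ε / 2 + ε / 2 := add_lt_add hsA hsB
    _ = ε := add_halves ε

theorem IsSlowlyVarying.tendsto_ratio_of_bounded {L : ℝ → ℝ} (hL : IsSlowlyVarying L)
    {x t : ℕ → ℝ} {T : ℝ} (hx : Tendsto x atTop atTop) (ht : ∀ n, |t n| ≤ T) :
    Tendsto (fun n => L (Real.exp (t n) * x n) / L (x n)) atTop (𝓝 1) := by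
  set h : ℝ → ℝ := fun s => Real.log (L (Real.exp s)) with hh
  have hm : Measurable h := Real.measurable_log.comp (hL.measurable.comp Real.measurable_exp)
  have hpos : ∀ᶠ s in atTop, 0 < L (Real.exp s) := Real.tendsto_exp_atTop.eventually hL.eventually_pos
  have hdiff : ∀ u, Tendsto (fun s => h (s + u) - h s) atTop (𝓝 0) := by
    intro u
    have h1 := (hL.tendsto_ratio (Real.exp u) (Real.exp_pos u)).comp Real.tendsto_exp_atTop
    have h2 := (Real.continuousAt_log one_ne_zero).tendsto.comp h1
    rw [Real.log_one] at h2
    refine h2.congr' ?_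
    filter_upwards [hpos, (tendsto_atTop_add_const_right _ u tendsto_id).eventually hpos] with s h3 h4
    simp only [Function.comp_apply, hh, id] at h4 ⊢
    rw [← Real.exp_add, add_comm u s, Real.log_div h4.ne' h3.ne']
  have hy : Tendsto (fun n => Real.log (x n)) atTop atTop := Real.tendsto_log_atTop.comp hx
  have hyt : Tendsto (fun n => Real.log (x n) + t n) atTop atTop :=
    tendsto_atTop_add_right_of_le _ (-T) hy fun n => (abs_le.1 (ht n)).1
  have key := (Real.continuous_exp.tendsto 0).comp (tendsto_sub_of_bounded_shift hm hdiff hy ht)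
  rw [Real.exp_zero] at key
  refine key.congr' ?_
  filter_upwards [hy.eventually hpos, hyt.eventually hpos, hx.eventually_gt_atTop 0] with n h1 h2 h3
  simp only [Function.comp_apply, hh]
  rw [Real.exp_sub, Real.exp_log h1, Real.exp_log h2, Real.exp_add, Real.exp_log h3, mul_comm]

/-- Regular variation, with exponent `-β`, of a sequence (uniformly on compact sets). -/
def RegVar (u : ℕ → ℝ) (β : ℝ) : Prop :=
  (∀ᶠ n in atTop, 0 < u n) ∧ ∀ a b : ℝ, 0 < a → ∀ ε : ℝ, 0 < ε → ∀ᶠ n : ℕ in atTop, ∀ j : ℕ,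
    a * n ≤ j → (j : ℝ) ≤ b * n → |u j - ((j : ℝ) / n) ^ (-β) * u n| ≤ ε * u n

/-- A failure would give sequences `n k → ∞` and `j k` with `j k / n k` confined to `[a, b]`, hence
bounded logarithms, contradicting `tendsto_ratio_of_bounded`. -/
theorem IsSlowlyVarying.eventually_abs_ratio_sub_one_le {L : ℝ → ℝ} (hL : IsSlowlyVarying L)
    {a b ε : ℝ} (ha : 0 < a) (hε : 0 < ε) :
    ∀ᶠ n : ℕ in atTop, ∀ j : ℕ, a * n ≤ j → (j : ℝ) ≤ b * n → |L j / L n - 1| ≤ ε := by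
  by_contra hcon
  rw [not_eventually, frequently_atTop] at hcon
  push Not at hcon
  have hcon' : ∀ k : ℕ, ∃ n, k + 1 ≤ n ∧ ∃ j : ℕ, a * n ≤ j ∧ (j : ℝ) ≤ b * n ∧
    ε < |L j / L n - 1| := fun k => hcon (k + 1)
  choose n hn j hj1 hj2 hj3 using hcon'
  have hnpos : ∀ k, (0 : ℝ) < n k := fun k => by
    have := hn k
    exact_mod_cast (by omega : 0 < n k)
  have hx : Tendsto (fun k => (n k : ℝ)) atTop atTop :=
    tendsto_natCast_atTop_atTop.comp (tendsto_atTop_mono (fun k => (Nat.le_succ k).trans (hn k)) tendsto_id)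
  have hjn1 : ∀ k, a ≤ (j k : ℝ) / n k := fun k => (le_div_iff₀ (hnpos k)).2 (hj1 k)
  have hjn2 : ∀ k, (j k : ℝ) / n k ≤ b := fun k => (div_le_iff₀ (hnpos k)).2 (hj2 k)
  have ht : ∀ k, |Real.log ((j k : ℝ) / n k)| ≤ max (|Real.log a|) (|Real.log b|) := by
    intro k
    have h1 := Real.log_le_log ha (hjn1 k)
    have h2 := Real.log_le_log (ha.trans_le (hjn1 k)) (hjn2 k)
    exact abs_le_max_abs_abs h1 h2
  have h := hL.tendsto_ratio_of_bounded hx ht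
  have h2 : ∀ k, Real.exp (Real.log ((j k : ℝ) / n k)) * n k = j k := by
    intro k
    rw [Real.exp_log (ha.trans_le (hjn1 k)), div_mul_cancel₀ _ (hnpos k).ne']
  simp only [h2] at h
  obtain ⟨k, hk⟩ := (h.eventually (Metric.closedBall_mem_nhds 1 hε)).exists
  rw [Real.dist_eq] at hk
  exact absurd hk (not_le.2 (hj3 k))

theorem IsSlowlyVarying.regVar {L : ℝ → ℝ} (hL : IsSlowlyVarying L) {β : ℝ} (hβ : 0 < β)
    {u : ℕ → ℝ} (hu : ∀ i : ℕ, 1 ≤ i → u i = L i * (i : ℝ) ^ (-β)) : RegVar u β := by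
  have hLpos : ∀ᶠ n : ℕ in atTop, 0 < L n :=
    tendsto_natCast_atTop_atTop.eventually hL.eventually_pos
  refine ⟨?_, ?_⟩
  · filter_upwards [hLpos, eventually_ge_atTop 1] with n h1 h2
    rw [hu n h2]
    have : (0 : ℝ) < n := by exact_mod_cast h2
    positivity
  · intro a b ha ε hε
    filter_upwards [hLpos, eventually_ge_atTop 1, hL.eventually_abs_ratio_sub_one_le (b := b) ha
      (mul_pos hε (Real.rpow_pos_of_pos ha β))] with n h1 h2 h3 j hj1 hj2
    have hn : (0 : ℝ) < n := by exact_mod_cast h2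
    have hj : (0 : ℝ) < j := (mul_pos ha hn).trans_le hj1
    have hj' : 1 ≤ j := by exact_mod_cast hj
    have hq : a ≤ (j : ℝ) / n := (le_div_iff₀ hn).2 hj1
    rw [hu j hj', hu n h2]
    have e1 : ((j : ℝ) / n) ^ (-β) * (n : ℝ) ^ (-β) = (j : ℝ) ^ (-β) := by
      rw [← Real.mul_rpow (by positivity) hn.le, div_mul_cancel₀ _ hn.ne']
    have e2 : L j * (j : ℝ) ^ (-β) - ((j : ℝ) / n) ^ (-β) * (L n * (n : ℝ) ^ (-β)) =
        (((j : ℝ) / n) ^ (-β) * (L n * (n : ℝ) ^ (-β))) * (L j / L n - 1) := by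
      rw [← e1]; field_simp
    have hpos : 0 < L n * (n : ℝ) ^ (-β) := mul_pos h1 (Real.rpow_pos_of_pos hn _)
    have hq' : ((j : ℝ) / n) ^ (-β) ≤ a ^ (-β) :=
      Real.rpow_le_rpow_of_nonpos ha hq (by linarith)
    have hpos2 : 0 ≤ ((j : ℝ) / n) ^ (-β) := by positivity
    rw [e2, abs_mul, abs_of_nonneg (mul_nonneg hpos2 hpos.le)]
    calc _ ≤ (a ^ (-β) * (L n * (n : ℝ) ^ (-β))) * (ε * a ^ β) := by
            gcongr
            exact h3 j hj1 hj2
      _ = (a ^ (-β) * a ^ β) * ε * (L n * (n : ℝ) ^ (-β)) := by ring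
      _ = _ := by rw [← Real.rpow_add ha]; simp

/-! ### Potter bounds and their consequences -/

namespace RegVar

variable {u : ℕ → ℝ} {β : ℝ}

/-- Potter's bounds. Within one doubling, `u` follows the power law up to a factor `1 ± η`;
iterating over dyadic scales, these factors accumulate but are absorbed by the slack `ε` in the
exponent. -/
theorem exists_upper_lower (hu : RegVar u β) (hβ : 0 < β) {ε : ℝ} (hε : 0 < ε) :
    ∃ n₀ : ℕ, 1 ≤ n₀ ∧ (∀ n ≥ n₀, 0 < u n) ∧ ∀ n ≥ n₀, ∀ j ≥ n,
      ((j : ℝ) / n) ^ (-β - ε) * u n ≤ 2 * u j ∧ u j ≤ 2 * ((j : ℝ) / n) ^ (-β + ε) * u n := by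
  have h32 : (1 : ℝ) < (3 / 2 : ℝ) ^ ε := Real.one_lt_rpow (by norm_num) hε
  have h32' : (3 / 2 : ℝ) ^ (-ε) < 1 := Real.rpow_lt_one_of_one_lt_of_neg (by norm_num) (by linarith)
  obtain ⟨η, hη, hη1, hη2, hη3⟩ : ∃ η : ℝ, 0 < η ∧ η ≤ 1 / 2 ∧ 1 + η ≤ (3 / 2 : ℝ) ^ ε ∧
      (3 / 2 : ℝ) ^ (-ε) ≤ 1 - η := by
    refine ⟨min (1 / 2) (min ((3 / 2 : ℝ) ^ ε - 1) (1 - (3 / 2 : ℝ) ^ (-ε))), ?_, min_le_left _ _, ?_, ?_⟩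
    · exact lt_min (by norm_num) (lt_min (by linarith) (by linarith))
    · have := (min_le_right (1 / 2 : ℝ) _).trans
        (min_le_left ((3 / 2 : ℝ) ^ ε - 1) (1 - (3 / 2 : ℝ) ^ (-ε)))
      linarith
    · have := (min_le_right (1 / 2 : ℝ) _).trans
        (min_le_right ((3 / 2 : ℝ) ^ ε - 1) (1 - (3 / 2 : ℝ) ^ (-ε)))
      linarith
  obtain ⟨n₀, hn₀⟩ := eventually_atTop.1 (hu.1.and (hu.2 1 2 one_pos (η * 2 ^ (-β))
    (mul_pos hη (by positivity))))
  have hstep : ∀ n ≥ max n₀ 1, ∀ j : ℕ, n ≤ j → j ≤ 2 * n →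
      (1 - η) * ((j : ℝ) / n) ^ (-β) * u n ≤ u j ∧ u j ≤ (1 + η) * ((j : ℝ) / n) ^ (-β) * u n := by
    intro n hn j h1 h2
    have hnp : (0 : ℝ) < n := by
      have := (le_max_right n₀ 1).trans hn
      exact_mod_cast this
    obtain ⟨hup, h3⟩ := hn₀ n ((le_max_left _ _).trans hn)
    have h4 := h3 j (by rw [one_mul]; exact_mod_cast h1) (by exact_mod_cast h2)
    have hq1 : (1 : ℝ) ≤ (j : ℝ) / n := (one_le_div₀ hnp).2 (by exact_mod_cast h1)
    have hq : (2 : ℝ) ^ (-β) ≤ ((j : ℝ) / n) ^ (-β) :=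
      Real.rpow_le_rpow_of_nonpos (by linarith)
        ((div_le_iff₀ hnp).2 (by exact_mod_cast h2)) (by linarith)
    have h5 : η * 2 ^ (-β) * u n ≤ η * ((j : ℝ) / n) ^ (-β) * u n := by gcongr
    have h6 := abs_le.1 h4
    constructor <;> nlinarith [h6.1, h6.2]
  refine ⟨max n₀ 1, le_max_right _ _, fun n hn => (hn₀ n ((le_max_left _ _).trans hn)).1, ?_⟩
  intro n hn j
  have hnp : (0 : ℝ) < n := by
    have := (le_max_right n₀ 1).trans hn
    exact_mod_cast this
  have hup : 0 < u n := (hn₀ n ((le_max_left _ _).trans hn)).1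
  have hn1 : 1 ≤ n := by exact_mod_cast hnp
  induction j using Nat.strong_induction_on with
  | _ j ih =>
  intro hj
  by_cases h2 : j ≤ 2 * n
  · obtain ⟨h3, h4⟩ := hstep n hn j hj h2
    have hq1 : (1 : ℝ) ≤ (j : ℝ) / n := (one_le_div₀ hnp).2 (by exact_mod_cast hj)
    have e1 : ((j : ℝ) / n) ^ (-β - ε) ≤ ((j : ℝ) / n) ^ (-β) :=
      Real.rpow_le_rpow_of_exponent_le hq1 (by linarith)
    have e2 : ((j : ℝ) / n) ^ (-β) ≤ ((j : ℝ) / n) ^ (-β + ε) :=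
      Real.rpow_le_rpow_of_exponent_le hq1 (by linarith)
    have e3 : 0 < ((j : ℝ) / n) ^ (-β) := by positivity
    constructor
    · calc _ ≤ ((j : ℝ) / n) ^ (-β) * u n := by gcongr
        _ = 2 * ((1 - 1 / 2) * ((j : ℝ) / n) ^ (-β) * u n) := by ring
        _ ≤ 2 * ((1 - η) * ((j : ℝ) / n) ^ (-β) * u n) := by gcongr
        _ ≤ _ := by gcongr
    · refine h4.trans ?_
      gcongr
      linarith
  · push Not at h2
    -- Rounding up keeps `j ≤ 2 * i`, and still `j / i ≥ 3 / 2`; this is why `η` was chosen against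
    -- `(3 / 2) ^ ε`. The constant `2` is spent only at the last scale.
    set i := (j + 1) / 2 with hi
    have hij : i < j := by omega
    have hni : n ≤ i := by omega
    have hip : (0 : ℝ) < i := by
      have : 0 < i := by omega
      exact_mod_cast this
    obtain ⟨h3, h4⟩ := hstep i (le_trans hn hni) j hij.le (by omega)
    obtain ⟨h5, h6⟩ := ih i hij hni
    have hq : (3 / 2 : ℝ) ≤ (j : ℝ) / i := by
      rw [le_div_iff₀ hip]
      have : 3 * i ≤ 2 * j := by omega
      have : (3 : ℝ) * i ≤ 2 * j := by exact_mod_cast this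
      linarith
    have hq0 : (0 : ℝ) < (j : ℝ) / i := by linarith
    have hin : (0 : ℝ) < (i : ℝ) / n := by positivity
    have hui : 0 < u i := (hn₀ i ((le_max_left _ _).trans (le_trans hn hni))).1
    have hmul : ∀ x : ℝ, ((j : ℝ) / n) ^ x = ((j : ℝ) / i) ^ x * ((i : ℝ) / n) ^ x := by
      intro x
      rw [← Real.mul_rpow hq0.le hin.le]
      congr 1
      field_simp
    have hε1 : ((j : ℝ) / i) ^ (-ε) ≤ 1 - η :=
      (Real.rpow_le_rpow_of_nonpos (by norm_num) hq (by linarith)).trans hη3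
    have hε2 : 1 + η ≤ ((j : ℝ) / i) ^ ε :=
      hη2.trans (Real.rpow_le_rpow (by norm_num) hq hε.le)
    have hb : 0 < ((j : ℝ) / i) ^ (-β) := Real.rpow_pos_of_pos hq0 _
    constructor
    · calc ((j : ℝ) / n) ^ (-β - ε) * u n
          = ((j : ℝ) / i) ^ (-β - ε) * (((i : ℝ) / n) ^ (-β - ε) * u n) := by rw [hmul]; ring
        _ ≤ ((j : ℝ) / i) ^ (-β - ε) * (2 * u i) := by gcongr
        _ = 2 * (((j : ℝ) / i) ^ (-ε) * ((j : ℝ) / i) ^ (-β) * u i) := by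
            rw [← Real.rpow_add hq0, show -ε + -β = -β - ε by ring]; ring
        _ ≤ 2 * ((1 - η) * ((j : ℝ) / i) ^ (-β) * u i) := by gcongr
        _ ≤ 2 * u j := by gcongr
    · calc u j ≤ (1 + η) * ((j : ℝ) / i) ^ (-β) * u i := h4
        _ ≤ ((j : ℝ) / i) ^ ε * ((j : ℝ) / i) ^ (-β) * u i := by gcongr
        _ = ((j : ℝ) / i) ^ (-β + ε) * u i := by
            rw [← Real.rpow_add hq0, show ε + -β = -β + ε by ring]
        _ ≤ ((j : ℝ) / i) ^ (-β + ε) * (2 * ((i : ℝ) / n) ^ (-β + ε) * u n) := by gcongr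
        _ = _ := by rw [hmul]; ring

theorem tendsto_ratio (hu : RegVar u β) {j : ℕ → ℕ} {θ : ℝ} (hθ : 0 < θ)
    (hj : Tendsto (fun n => (j n : ℝ) / n) atTop (𝓝 θ)) :
    Tendsto (fun n => u (j n) / u n) atTop (𝓝 (θ ^ (-β))) := by
  have h1 : Tendsto (fun n => ((j n : ℝ) / n) ^ (-β)) atTop (𝓝 (θ ^ (-β))) :=
    hj.rpow_const (Or.inl hθ.ne')
  have h2 : Tendsto (fun n => u (j n) / u n - ((j n : ℝ) / n) ^ (-β)) atTop (𝓝 0) := by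
    rw [Metric.tendsto_nhds]
    intro ε hε
    filter_upwards [hu.1, hu.2 (θ / 2) (2 * θ) (half_pos hθ) (ε / 2) (half_pos hε),
      hj.eventually (lt_mem_nhds (half_lt_self hθ)),
      hj.eventually (gt_mem_nhds (by linarith : θ < 2 * θ)), eventually_gt_atTop 0]
      with n h1 h2 h3 h4 h5
    have hn : (0 : ℝ) < n := by exact_mod_cast h5
    have := h2 (j n) ((lt_div_iff₀ hn).1 h3).le ((div_lt_iff₀ hn).1 h4).le
    rw [Real.dist_eq, sub_zero]
    have e : u (j n) / u n - ((j n : ℝ) / n) ^ (-β) =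
      (u (j n) - ((j n : ℝ) / n) ^ (-β) * u n) / u n := by field_simp
    rw [e, abs_div, abs_of_pos h1, div_lt_iff₀ h1]
    refine this.trans_lt ?_
    gcongr
    linarith
  simpa using h2.add h1

theorem tendsto_ratio_sub (hu : RegVar u β) (i : ℕ) :
    Tendsto (fun n => u (n - i) / u n) atTop (𝓝 1) := by
  have := hu.tendsto_ratio (j := fun n => n - i) one_pos ?_
  · simpa using this
  · have h1 : Tendsto (fun n : ℕ => 1 - (i : ℝ) / n) atTop (𝓝 (1 - 0)) :=
      tendsto_const_nhds.sub (tendsto_const_div_atTop_nhds_zero_nat _)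
    rw [sub_zero] at h1
    refine h1.congr' ?_
    filter_upwards [eventually_ge_atTop (i + 1)] with n hn
    have hn' : (n : ℝ) ≠ 0 := by
      have : n ≠ 0 := by omega
      exact_mod_cast this
    rw [Nat.cast_sub (by omega)]
    field_simp

theorem tendsto_ratio_succ (hu : RegVar u β) :
    Tendsto (fun n => u (n + 1) / u n) atTop (𝓝 1) := by
  have := hu.tendsto_ratio (j := fun n => n + 1) one_pos ?_
  · simpa using this
  · have h1 : Tendsto (fun n : ℕ => 1 + (1 : ℝ) / n) atTop (𝓝 (1 + 0)) :=
      tendsto_const_nhds.add (tendsto_const_div_atTop_nhds_zero_nat _)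
    rw [add_zero] at h1
    refine h1.congr' ?_
    filter_upwards [eventually_ge_atTop 1] with n hn
    have hn' : (n : ℝ) ≠ 0 := by
      have : n ≠ 0 := by omega
      exact_mod_cast this
    push_cast
    field_simp

/-- Regular variation only depends on the asymptotic behaviour up to a constant factor. -/
theorem of_tendsto_div (hu : RegVar u β) (hβ : 0 < β) {v : ℕ → ℝ} {c : ℝ} (hc : 0 < c)
    (hv : Tendsto (fun n => v n / u n) atTop (𝓝 c)) : RegVar v β := by
  have hclose : ∀ δ > 0, ∀ᶠ n in atTop, |v n - c * u n| ≤ δ * u n := by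
    intro δ hδ
    filter_upwards [hu.1, hv.eventually (Metric.closedBall_mem_nhds c hδ)] with n h1 h2
    rw [Real.dist_eq] at h2
    have e : v n - c * u n = (v n / u n - c) * u n := by field_simp
    rw [e, abs_mul, abs_of_pos h1]
    gcongr
  have hlow : ∀ᶠ n in atTop, c / 2 * u n ≤ v n := by
    filter_upwards [hclose (c / 2) (half_pos hc)] with n h1
    have := (abs_le.1 h1).1
    linarith
  refine ⟨?_, ?_⟩
  · filter_upwards [hu.1, hlow] with n h1 h2
    exact (mul_pos (half_pos hc) h1).trans_le h2
  · intro a b ha ε hε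
    -- `K` sums the weights of the three errors in `e4`: `a ^ (-β) + 1` at `j`, `c` for the regular
    -- variation of `u`, and `a ^ (-β)` at `n`.
    set K := c + 2 * a ^ (-β) + 1 with hK
    have hKpos : 0 < K := by positivity
    set δ := min 1 (ε * (c / 2) / K) with hδdef
    have hδ : 0 < δ := by positivity
    have hδ1 : δ ≤ 1 := min_le_left _ _
    have hδ2 : δ * K ≤ ε * (c / 2) := by
      rw [← le_div_iff₀ hKpos]; exact min_le_right _ _
    obtain ⟨N, hN⟩ := eventually_atTop.1 (hclose δ hδ)
    have hbig : ∀ᶠ n : ℕ in atTop, (N : ℝ) ≤ a * n :=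
      (tendsto_natCast_atTop_atTop.const_mul_atTop ha).eventually_ge_atTop _
    filter_upwards [hu.1, hlow, hu.2 a b ha δ hδ, eventually_ge_atTop N, hbig,
      eventually_gt_atTop 0] with n h1 h2 h3 h4 h5 h6 j hj1 hj2
    have hn : (0 : ℝ) < n := by exact_mod_cast h6
    have hjN : N ≤ j := by exact_mod_cast h5.trans hj1
    have hq : ((j : ℝ) / n) ^ (-β) ≤ a ^ (-β) :=
      Real.rpow_le_rpow_of_nonpos ha ((le_div_iff₀ hn).2 hj1) (by linarith)
    set q := ((j : ℝ) / n) ^ (-β) with hqdef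
    have hq0 : 0 ≤ q := by positivity
    have e1 := h3 j hj1 hj2
    have e2 := hN j hjN
    have e3 := hN n h4
    have huj : u j ≤ (a ^ (-β) + 1) * u n := by
      have := (abs_le.1 e1).2
      have h7 : q * u n ≤ a ^ (-β) * u n := by gcongr
      have h8 : δ * u n ≤ 1 * u n := by gcongr
      linarith
    have e4 : |v j - q * v n| ≤ δ * K * u n := by
      have : v j - q * v n = (v j - c * u j) + c * (u j - q * u n) - q * (v n - c * u n) := by ring
      rw [this]
      calc _ ≤ |v j - c * u j| + |c * (u j - q * u n)| + |q * (v n - c * u n)| :=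
            (abs_sub _ _).trans (by gcongr; exact abs_add_le _ _)
        _ ≤ δ * ((a ^ (-β) + 1) * u n) + c * (δ * u n) + a ^ (-β) * (δ * u n) := by
            rw [abs_mul, abs_mul, abs_of_pos hc, abs_of_nonneg hq0]
            gcongr
            exact e2.trans (by gcongr)
        _ = _ := by rw [hK]; ring
    calc _ ≤ _ := e4
      _ ≤ ε * (c / 2) * u n := by gcongr
      _ = ε * (c / 2 * u n) := by ring
      _ ≤ _ := by gcongr

theorem succ (hu : RegVar u β) (hβ : 0 < β) : RegVar (fun n => u (n + 1)) β :=
  hu.of_tendsto_div hβ one_pos hu.tendsto_ratio_succ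

theorem exists_le_mul (hu : RegVar u β) (hβ : 0 < β) {a : ℝ} (ha : 0 < a) :
    ∃ C : ℝ, 0 < C ∧ ∀ᶠ n : ℕ in atTop, ∀ j : ℕ, a * n ≤ j → u j ≤ C * u n := by
  obtain ⟨n₀, hn₀, hpos, h⟩ := hu.exists_upper_lower hβ hβ
  refine ⟨max (a ^ (-β) + 1) 2, by positivity, ?_⟩
  filter_upwards [eventually_ge_atTop n₀, hu.2 a 1 ha 1 one_pos] with n hn h2 j hj
  have hup := hpos n hn
  have hnp : (0 : ℝ) < n := by exact_mod_cast hn₀.trans hn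
  by_cases hjn : j ≤ n
  · have h3 := (abs_le.1 (h2 j hj (by rw [one_mul]; exact_mod_cast hjn))).2
    have hq : ((j : ℝ) / n) ^ (-β) ≤ a ^ (-β) :=
      Real.rpow_le_rpow_of_nonpos ha ((le_div_iff₀ hnp).2 hj) (by linarith)
    calc u j ≤ (((j : ℝ) / n) ^ (-β) + 1) * u n := by linarith
      _ ≤ (a ^ (-β) + 1) * u n := by gcongr
      _ ≤ _ := by gcongr; exact le_max_left _ _
  · have h3 := (h n hn j (by omega)).2
    rw [neg_add_cancel, Real.rpow_zero, mul_one] at h3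
    exact h3.trans (by gcongr; exact le_max_right _ _)

theorem exists_le_rpow (hu : RegVar u β) (hβ : 0 < β) {b : ℝ} (hb : b < β) :
    ∃ C : ℝ, 0 < C ∧ ∀ᶠ n : ℕ in atTop, u n ≤ C * (n : ℝ) ^ (-b) := by
  obtain ⟨n₀, hn₀, hpos, h⟩ := hu.exists_upper_lower hβ (sub_pos.2 hb)
  have hnp : (0 : ℝ) < n₀ := by exact_mod_cast hn₀
  have hup := hpos n₀ le_rfl
  refine ⟨2 * (n₀ : ℝ) ^ b * u n₀, by positivity, ?_⟩
  filter_upwards [eventually_ge_atTop n₀] with n hn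
  have h3 := (h n₀ le_rfl n hn).2
  refine h3.trans (le_of_eq ?_)
  rw [show -β + (β - b) = -b by ring, Real.div_rpow (by positivity) hnp.le, Real.rpow_neg hnp.le b]
  field_simp

theorem exists_rpow_le (hu : RegVar u β) (hβ : 0 < β) {b : ℝ} (hb : β < b) :
    ∃ c : ℝ, 0 < c ∧ ∀ᶠ n : ℕ in atTop, c * (n : ℝ) ^ (-b) ≤ u n := by
  obtain ⟨n₀, hn₀, hpos, h⟩ := hu.exists_upper_lower hβ (sub_pos.2 hb)
  have hnp : (0 : ℝ) < n₀ := by exact_mod_cast hn₀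
  have hup := hpos n₀ le_rfl
  refine ⟨(n₀ : ℝ) ^ b * u n₀ / 2, by positivity, ?_⟩
  filter_upwards [eventually_ge_atTop n₀] with n hn
  have h3 := (h n₀ le_rfl n hn).1
  rw [show -β - (b - β) = -b by ring, Real.div_rpow (by positivity) hnp.le,
    Real.rpow_neg hnp.le b] at h3
  have e : (n : ℝ) ^ (-b) / ((n₀ : ℝ) ^ b)⁻¹ * u n₀ = 2 * ((n₀ : ℝ) ^ b * u n₀ / 2 * (n : ℝ) ^ (-b)) := by
    field_simp
  rw [e] at h3
  linarith

theorem id_mul (hu : RegVar u β) : RegVar (fun n => (n : ℝ) * u n) (β - 1) := by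
  refine ⟨?_, ?_⟩
  · filter_upwards [hu.1, eventually_gt_atTop 0] with n h1 h2
    have : (0 : ℝ) < n := by exact_mod_cast h2
    positivity
  · intro a b ha ε hε
    filter_upwards [hu.1, eventually_gt_atTop 0, hu.2 a b ha (ε / max b 1) (by positivity)]
      with n h1 h2 h3 j hj1 hj2
    have hn : (0 : ℝ) < n := by exact_mod_cast h2
    have hj : (0 : ℝ) < j := (mul_pos ha hn).trans_le hj1
    have hq : (0 : ℝ) < (j : ℝ) / n := by positivity
    have e : ((j : ℝ) / n) ^ (-(β - 1)) * (n * u n) = j * (((j : ℝ) / n) ^ (-β) * u n) := by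
      rw [show -(β - 1) = -β + 1 by ring, Real.rpow_add hq, Real.rpow_one]
      field_simp
    rw [e, ← mul_sub, abs_mul, abs_of_pos hj]
    calc _ ≤ (j : ℝ) * (ε / max b 1 * u n) := by gcongr; exact h3 j hj1 hj2
      _ ≤ (max b 1 * n) * (ε / max b 1 * u n) := by
          gcongr
          exact hj2.trans (by gcongr; exact le_max_left _ _)
      _ = _ := by field_simp

theorem eventually_forall_half (hu : RegVar u β) (hβ : 0 < β) :
    ∃ C : ℝ, 0 < C ∧ ∀ᶠ n : ℕ in atTop, ∀ j : ℕ, n ≤ 2 * j → 0 < u j ∧ u j ≤ C * u n := by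
  obtain ⟨C, hC, h⟩ := hu.exists_le_mul hβ (a := 1 / 2) (by norm_num)
  obtain ⟨N, hN⟩ := eventually_atTop.1 hu.1
  refine ⟨C, hC, ?_⟩
  filter_upwards [h, eventually_ge_atTop (2 * N)] with n h1 h2 j hj
  refine ⟨hN j (by omega), h1 j ?_⟩
  have : (n : ℝ) ≤ 2 * j := by exact_mod_cast hj
  linarith

/-- For `i ≤ n / 2` the ratio `u (n - i) / u n` is bounded and tends to `1`, so dominated
convergence applies. The rest of a convolution is estimated separately in each use. -/
theorem tendsto_sum_half (hu : RegVar u β) (hβ : 0 < β) {a : ℕ → ℝ} (ha : ∀ i, 0 ≤ a i)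
    (hs : Summable a) :
    Tendsto (fun n => (∑ i ∈ range (n / 2 + 1), a i * u (n - i)) / u n) atTop
      (𝓝 (∑' i, a i)) := by
  obtain ⟨C, hC, hCu⟩ := hu.eventually_forall_half hβ
  have key := tendsto_tsum_of_dominated_convergence (𝓕 := atTop)
    (f := fun n i => if i ∈ range (n / 2 + 1) then a i * (u (n - i) / u n) else 0)
    (g := a) (bound := fun i => C * a i) (hs.mul_left C) ?_ ?_
  · refine key.congr fun n => ?_
    rw [tsum_eq_sum (s := range (n / 2 + 1)) fun i hi => if_neg hi, sum_div]
    refine Finset.sum_congr rfl fun i hi => ?_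
    rw [if_pos hi, mul_div_assoc]
  · intro i
    have h1 : Tendsto (fun n => a i * (u (n - i) / u n)) atTop (𝓝 (a i)) := by
      simpa using (hu.tendsto_ratio_sub i).const_mul (a i)
    refine h1.congr' ?_
    filter_upwards [eventually_ge_atTop (2 * i)] with n hn
    rw [if_pos (mem_range.2 (by omega))]
  · filter_upwards [hCu] with n hn i
    split_ifs with hi
    · have hi' := mem_range.1 hi
      obtain ⟨h1, h2⟩ := hn (n - i) (by omega)
      have h3 := (hn n (by omega)).1
      rw [Real.norm_eq_abs, abs_of_nonneg (mul_nonneg (ha i) (by positivity)), mul_comm C]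
      refine mul_le_mul_of_nonneg_left ?_ (ha i)
      rwa [div_le_iff₀ h3]
    · rw [norm_zero]
      exact mul_nonneg hC.le (ha i)

end RegVar

/-! ### Convolutions of nonnegative summable sequences -/

theorem sum_range_sub_le_tsum {f : ℕ → ℝ} (hf : ∀ i, 0 ≤ f i) (hs : Summable f) {n : ℕ}
    {s : Finset ℕ} (hsn : s ⊆ range (n + 1)) : ∑ i ∈ s, f (n - i) ≤ ∑' i, f i := by
  calc _ ≤ ∑ i ∈ range (n + 1), f (n - i) :=
        sum_le_sum_of_subset_of_nonneg hsn fun i _ _ => hf _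
    _ = ∑ i ∈ range (n + 1), f i := by
        have := Finset.sum_range_reflect f (n + 1)
        simpa using this
    _ ≤ _ := hs.sum_le_tsum _ fun i _ => hf i

theorem sum_range_succ_eq_half_add (f : ℕ → ℝ) (n : ℕ) :
    ∑ i ∈ range (n + 1), f i = ∑ i ∈ range (n / 2 + 1), f i + ∑ i ∈ Ico (n / 2 + 1) (n + 1), f i := by
  rw [range_eq_Ico, range_eq_Ico, sum_Ico_consecutive _ (by omega) (by omega)]

namespace PowerSeries

theorem coeff_mul_range (A B : ℝ⟦X⟧) (n : ℕ) :
    coeff n (A * B) = ∑ i ∈ range (n + 1), coeff i A * coeff (n - i) B := by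
  rw [coeff_mul, Finset.Nat.sum_antidiagonal_eq_sum_range_succ_mk]

theorem hasSum_coeff_mul {A B : ℝ⟦X⟧} (hA : ∀ n, 0 ≤ coeff n A) (hB : ∀ n, 0 ≤ coeff n B)
    {a b : ℝ} (ha : HasSum (fun n => coeff n A) a) (hb : HasSum (fun n => coeff n B) b) :
    HasSum (fun n => coeff n (A * B)) (a * b) := by
  have h1 : Summable fun n => ‖coeff n A‖ := by simpa [abs_of_nonneg (hA _)] using ha.summable
  have h2 : Summable fun n => ‖coeff n B‖ := by simpa [abs_of_nonneg (hB _)] using hb.summable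
  have h3 := tsum_mul_tsum_eq_tsum_sum_antidiagonal_of_summable_norm h1 h2
  have h4 := (summable_norm_sum_mul_antidiagonal_of_summable_norm h1 h2).of_norm
  rw [ha.tsum_eq, hb.tsum_eq] at h3
  rw [h3]
  simp only [coeff_mul]
  exact h4.hasSum

theorem coeff_mul_nonneg {A B : ℝ⟦X⟧} (hA : ∀ n, 0 ≤ coeff n A) (hB : ∀ n, 0 ≤ coeff n B) (n : ℕ) :
    0 ≤ coeff n (A * B) := by
  rw [coeff_mul]
  exact Finset.sum_nonneg fun x _ => mul_nonneg (hA _) (hB _)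

/-! ### The defective renewal series `H = c / (1 - G)` -/

section Renewal

variable {G H : ℝ⟦X⟧} {c : ℝ}

theorem renewal_coeff (hH : H * (1 - G) = C c) (n : ℕ) :
    (1 - coeff 0 G) * coeff n H = (if n = 0 then c else 0) +
      ∑ i ∈ range n, coeff (i + 1) G * coeff (n - (i + 1)) H := by
  have h1 : H = C c + G * H := by linear_combination hH
  have h2 := congrArg (coeff n) h1
  rw [map_add, coeff_C, coeff_mul_range, sum_range_succ'] at h2
  simp only [Nat.sub_zero] at h2
  linarith

theorem renewal_nonneg (hc : 0 < c) (hG : ∀ n, 0 ≤ coeff n G)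
    (hGs : HasSum (fun n => coeff n G) (1 - c)) (hH : H * (1 - G) = C c) (n : ℕ) :
    0 ≤ coeff n H := by
  have hg0 : coeff 0 G ≤ 1 - c := le_hasSum hGs 0 fun i _ => hG i
  induction n using Nat.strong_induction_on with
  | _ n ih =>
  have h := renewal_coeff hH n
  have h2 : 0 ≤ (1 - coeff 0 G) * coeff n H := by
    rw [h]
    refine add_nonneg (by split_ifs <;> linarith) (Finset.sum_nonneg fun i hi => ?_)
    exact mul_nonneg (hG _) (ih _ (by have := mem_range.1 hi; omega))
  exact nonneg_of_mul_nonneg_right h2 (by linarith)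

/-- The equation `H = c + G * H` bounds each partial sum by `S ≤ c + (1 - c) * S`, whence
summability; summing the equation then forces the total `1`. -/
theorem renewal_hasSum (hc : 0 < c) (hG : ∀ n, 0 ≤ coeff n G)
    (hGs : HasSum (fun n => coeff n G) (1 - c)) (hH : H * (1 - G) = C c) :
    HasSum (fun n => coeff n H) 1 := by
  have hH0 := renewal_nonneg hc hG hGs hH
  have h1 : H = C c + G * H := by linear_combination hH
  have hbd : ∀ N, ∑ n ∈ range N, coeff n H ≤ 1 := by
    intro N
    set S := ∑ n ∈ range N, coeff n H with hS
    have hS0 : 0 ≤ S := Finset.sum_nonneg fun n _ => hH0 n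
    have h2 : ∑ n ∈ range N, coeff n (G * H) ≤ (1 - c) * S := by
      set T : ℝ⟦X⟧ := mk fun n => if n ∈ range N then coeff n H else 0 with hT
      have hT0 : ∀ n, 0 ≤ coeff n T := fun n => by
        rw [hT, coeff_mk]; split_ifs <;> simp [hH0]
      have hTs : HasSum (fun n => coeff n T) S := by
        have : S = ∑ n ∈ range N, coeff n T :=
          Finset.sum_congr rfl fun n hn => by rw [hT, coeff_mk, if_pos hn]
        rw [this]
        exact hasSum_sum_of_ne_finset_zero fun n hn => by rw [hT, coeff_mk, if_neg hn]
      have hGT := hasSum_coeff_mul hG hT0 hGs hTs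
      refine (Finset.sum_congr rfl fun n hn => ?_).trans_le
        (sum_le_hasSum (range N) (fun n _ => coeff_mul_nonneg hG hT0 n) hGT)
      rw [coeff_mul_range, coeff_mul_range]
      refine Finset.sum_congr rfl fun i _ => ?_
      rw [hT, coeff_mk, if_pos (mem_range.2 (by have := mem_range.1 hn; omega))]
    have h3 : S = ∑ n ∈ range N, coeff n (C c : ℝ⟦X⟧) + ∑ n ∈ range N, coeff n (G * H) := by
      rw [hS, ← sum_add_distrib]
      refine Finset.sum_congr rfl fun n _ => ?_
      rw [← map_add, ← h1]
    have h4 : ∑ n ∈ range N, coeff n (C c : ℝ⟦X⟧) ≤ c := by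
      simp only [coeff_C, Finset.sum_ite_eq', mem_range]
      split_ifs <;> linarith
    nlinarith
  have hs : Summable fun n => coeff n H := summable_of_sum_range_le hH0 hbd
  have h5 := hasSum_coeff_mul hG hH0 hGs hs.hasSum
  have h6 : HasSum (fun n => coeff n (C c : ℝ⟦X⟧)) c := by
    simp only [coeff_C]
    exact hasSum_ite_eq 0 c
  have h7 := h6.add h5
  have h8 : (fun n => coeff n (C c : ℝ⟦X⟧) + coeff n (G * H)) = fun n => coeff n H := by
    funext n
    rw [← map_add, ← h1]
  rw [h8] at h7
  have h9 := h7.unique hs.hasSum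
  have : ∑' n, coeff n H = 1 := by
    have : c * ∑' n, coeff n H = c * 1 := by linarith
    exact mul_left_cancel₀ hc.ne' this
  rw [← this]
  exact hs.hasSum

/-- Induction through `H = c + G * H`. Terms with small index in `G` reproduce the constant `M` with
a factor less than `1`, because `G` has mass `1 - c`; the others contribute at most `D * coeff n G`.
-/
theorem renewal_le (hc : 0 < c) (hG : ∀ n, 0 ≤ coeff n G)
    (hGs : HasSum (fun n => coeff n G) (1 - c)) (hH : H * (1 - G) = C c) {β : ℝ} (hβ : 0 < β)
    (hreg : RegVar (fun n => coeff n G) β) :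
    ∃ M : ℝ, 0 < M ∧ ∀ᶠ n in atTop, coeff n H ≤ M * coeff n G := by
  have hH0 := renewal_nonneg hc hG hGs hH
  have hHs := renewal_hasSum hc hG hGs hH
  have hH1 : ∀ n, coeff n H ≤ 1 := fun n => le_hasSum hHs n fun i _ => hH0 i
  have hg0 : coeff 0 G ≤ 1 - c := le_hasSum hGs 0 fun i _ => hG i
  obtain ⟨D, hD, hDu⟩ := hreg.eventually_forall_half hβ
  have hT := hreg.tendsto_sum_half hβ hG hGs.summable
  rw [hGs.tsum_eq] at hT
  obtain ⟨N₁, hN₁⟩ := eventually_atTop.1 hreg.1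
  obtain ⟨N₂, hN₂⟩ := eventually_atTop.1
    (hDu.and (hT.eventually (gt_mem_nhds (by linarith : 1 - c < 1 - c / 2))))
  set N := max (max N₁ N₂) 1 with hN
  -- The part `2 * D / c` closes the induction, using the gap `c / 2` between `1 - c` and `1 - c /
  -- 2`; the sum of inverses covers `N ≤ n < 2 * N`, where only `coeff n H ≤ 1` is used.
  set M := 2 * D / c + ∑ n ∈ range (2 * N), (if N ≤ n then (coeff n G)⁻¹ else 0) with hM
  have hsum0 : ∀ n ∈ range (2 * N), 0 ≤ (if N ≤ n then (coeff n G)⁻¹ else (0 : ℝ)) := fun n _ => by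
    split_ifs
    · exact inv_nonneg.2 (hG n)
    · exact le_rfl
  have hMD : 2 * D / c ≤ M := le_add_of_nonneg_right (Finset.sum_nonneg hsum0)
  have hM0 : 0 < M := lt_of_lt_of_le (by positivity) hMD
  refine ⟨M, hM0, eventually_atTop.2 ⟨N, fun n => ?_⟩⟩
  induction n using Nat.strong_induction_on with
  | _ n ih =>
  intro hn
  have hgn : 0 < coeff n G := hN₁ n (by omega)
  by_cases hn2 : n < 2 * N
  · have h1 : (coeff n G)⁻¹ ≤ M := by
      have := Finset.single_le_sum hsum0 (mem_range.2 hn2)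
      rw [if_pos hn] at this
      have h2 : 0 ≤ 2 * D / c := by positivity
      linarith
    calc coeff n H ≤ 1 := hH1 n
      _ = (coeff n G)⁻¹ * coeff n G := (inv_mul_cancel₀ hgn.ne').symm
      _ ≤ _ := by gcongr
  · obtain ⟨hD1, hT1⟩ := hN₂ n (by omega)
    rw [div_lt_iff₀ hgn, sum_range_succ'] at hT1
    simp only [Nat.sub_zero] at hT1
    have hrec := renewal_coeff hH n
    rw [if_neg (by omega), zero_add] at hrec
    have hsplit : ∑ i ∈ range n, coeff (i + 1) G * coeff (n - (i + 1)) H =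
        ∑ i ∈ range (n / 2), coeff (i + 1) G * coeff (n - (i + 1)) H +
        ∑ i ∈ Ico (n / 2) n, coeff (i + 1) G * coeff (n - (i + 1)) H := by
      rw [range_eq_Ico, range_eq_Ico, sum_Ico_consecutive _ (by omega) (by omega)]
    have hA : ∑ i ∈ range (n / 2), coeff (i + 1) G * coeff (n - (i + 1)) H ≤
        M * ∑ i ∈ range (n / 2), coeff (i + 1) G * coeff (n - (i + 1)) G := by
      rw [mul_sum]
      refine Finset.sum_le_sum fun i hi => ?_
      have := mem_range.1 hi
      calc _ ≤ coeff (i + 1) G * (M * coeff (n - (i + 1)) G) :=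
            mul_le_mul_of_nonneg_left (ih _ (by omega) (by omega)) (hG _)
        _ = _ := by ring
    have hB : ∑ i ∈ Ico (n / 2) n, coeff (i + 1) G * coeff (n - (i + 1)) H ≤ D * coeff n G := by
      calc _ ≤ ∑ i ∈ Ico (n / 2) n, D * coeff n G * coeff (n - 1 - i) H := by
            refine Finset.sum_le_sum fun i hi => ?_
            have := mem_Ico.1 hi
            rw [show n - (i + 1) = n - 1 - i by omega]
            exact mul_le_mul_of_nonneg_right (hD1 (i + 1) (by omega)).2 (hH0 _)
        _ = D * coeff n G * ∑ i ∈ Ico (n / 2) n, coeff (n - 1 - i) H := by rw [mul_sum]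
        _ ≤ D * coeff n G * 1 := by
            gcongr
            rw [← hHs.tsum_eq]
            refine sum_range_sub_le_tsum hH0 hHs.summable (n := n - 1) ?_
            intro i hi
            have := mem_Ico.1 hi
            exact mem_range.2 (by omega)
        _ = _ := mul_one _
    rw [hsplit] at hrec
    have hE : M * ∑ i ∈ range (n / 2), coeff (i + 1) G * coeff (n - (i + 1)) G ≤
        M * ((1 - c / 2) * coeff n G - coeff 0 G * coeff n G) := by
      gcongr
      linarith
    have hMc : D ≤ M * (c / 2) := by
      rw [div_le_iff₀ hc] at hMD
      linarith
    have hF : D * coeff n G ≤ M * (c / 2) * coeff n G := by gcongr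
    have h0 : 0 < 1 - coeff 0 G := by linarith
    have : (1 - coeff 0 G) * coeff n H ≤ (1 - coeff 0 G) * (M * coeff n G) := by
      linarith
    exact le_of_mul_le_mul_left this h0

/-- In `i + (n - i) = n` one of the two indices is at least `n / 2`; bound that factor by `u n` and
sum the other. -/
theorem sq_le_of_le (hH0 : ∀ n, 0 ≤ coeff n H) (hHs : HasSum (fun n => coeff n H) 1) {β : ℝ}
    (hβ : 0 < β) {u : ℕ → ℝ} (hreg : RegVar u β) {M : ℝ} (hM0 : 0 < M)
    (hM : ∀ᶠ n in atTop, coeff n H ≤ M * u n) :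
    ∃ K : ℝ, 0 < K ∧ ∀ᶠ n in atTop, coeff n (H * H) ≤ K * u n := by
  obtain ⟨D, hD, hDu⟩ := hreg.eventually_forall_half hβ
  obtain ⟨N, hN⟩ := eventually_atTop.1 hM
  refine ⟨2 * (M * D), by positivity, ?_⟩
  filter_upwards [hDu, eventually_ge_atTop (2 * N)] with n hn hnN
  have hbig : ∀ j, n ≤ 2 * j → coeff j H ≤ M * D * u n := by
    intro j hj
    calc _ ≤ M * u j := hN j (by omega)
      _ ≤ M * (D * u n) := by gcongr; exact (hn j hj).2
      _ = _ := by ring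
  have hun : 0 < u n := (hn n (by omega)).1
  rw [coeff_mul_range]
  calc _ ≤ ∑ i ∈ range (n + 1), M * D * u n * (coeff i H + coeff (n - i) H) := by
        refine Finset.sum_le_sum fun i hi => ?_
        have := mem_range.1 hi
        have h1 := hH0 i
        have h2 := hH0 (n - i)
        have h3 : 0 ≤ M * D * u n := by positivity
        by_cases h : n ≤ 2 * i
        · calc _ ≤ M * D * u n * coeff (n - i) H := mul_le_mul_of_nonneg_right (hbig i h) h2
            _ ≤ _ := by gcongr; linarith
        · calc _ ≤ coeff i H * (M * D * u n) :=
                mul_le_mul_of_nonneg_left (hbig (n - i) (by omega)) h1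
            _ = M * D * u n * coeff i H := mul_comm _ _
            _ ≤ _ := by gcongr; linarith
    _ = M * D * u n * (∑ i ∈ range (n + 1), coeff i H + ∑ i ∈ range (n + 1), coeff (n - i) H) := by
        rw [← mul_sum, sum_add_distrib]
    _ ≤ M * D * u n * (1 + 1) := by
        gcongr
        · exact sum_le_hasSum _ (fun i _ => hH0 i) hHs
        · rw [← hHs.tsum_eq]
          exact sum_range_sub_le_tsum hH0 hHs.summable (n := n) (Finset.Subset.refl _)
    _ = _ := by ring

/-- Differentiating `H = c / (1 - G)` gives `c H' = H² G'`. The weight `n` turns the renewal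
equation into an explicit convolution. -/
theorem renewal_derivative (hH : H * (1 - G) = C c) :
    (mk fun n => (n : ℝ) * coeff n H) * C c = (H * H) * mk fun n => (n : ℝ) * coeff n G := by
  have hmk : ∀ A : ℝ⟦X⟧, (mk fun n => (n : ℝ) * coeff n A) = X * derivative ℝ A := by
    intro A
    ext n
    rcases n with _ | n
    · simp
    · rw [coeff_succ_X_mul, coeff_derivative, coeff_mk]
      push_cast
      ring
  rw [hmk, hmk]
  have h1 := congrArg (derivative ℝ) hH
  rw [(derivative ℝ).leibniz, map_sub, Derivation.map_one_eq_zero] at h1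
  have h2 : derivative ℝ (C c : ℝ⟦X⟧) = 0 := derivative_C
  rw [h2] at h1
  simp only [smul_eq_mul] at h1
  linear_combination X * H * h1 - X * derivative ℝ H * hH

/-- By `renewal_derivative`, `c n h_n` is the convolution of `H * H`, of mass `1`, with `n g_n`. Its
first half is asymptotic to `n g_n`; in the second half the coefficients of `H * H` are `O(g_n)` and
`∑ n g_n` is finite, so that half is `O(g_n) = o(n g_n)`. -/
theorem renewal_tendsto (hc : 0 < c) (hG : ∀ n, 0 ≤ coeff n G)
    (hGs : HasSum (fun n => coeff n G) (1 - c)) (hH : H * (1 - G) = C c) {β : ℝ} (hβ : 1 < β)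
    (hreg : RegVar (fun n => coeff n G) β) (hGm : Summable fun n : ℕ => (n : ℝ) * coeff n G) :
    Tendsto (fun n => coeff n H / coeff n G) atTop (𝓝 (1 / c)) := by
  have hβ0 : 0 < β := by linarith
  have hH0 := renewal_nonneg hc hG hGs hH
  have hHs := renewal_hasSum hc hG hGs hH
  have hHH := hasSum_coeff_mul hH0 hH0 hHs hHs
  have hHH0 := coeff_mul_nonneg hH0 hH0
  rw [one_mul] at hHH
  have hV0 : ∀ n : ℕ, 0 ≤ (n : ℝ) * coeff n G := fun n => mul_nonneg n.cast_nonneg (hG n)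
  obtain ⟨M, hM0, hM⟩ := renewal_le hc hG hGs hH hβ0 hreg
  obtain ⟨K, hK0, hK⟩ := sq_le_of_le hH0 hHs hβ0 hreg hM0 hM
  obtain ⟨D, hD, hDu⟩ := hreg.eventually_forall_half hβ0
  obtain ⟨N, hN⟩ := eventually_atTop.1 hK
  have hT := hreg.id_mul.tendsto_sum_half (by linarith) hHH0 hHH.summable
  rw [hHH.tsum_eq] at hT
  set S := ∑' n : ℕ, (n : ℝ) * coeff n G with hS
  have hR : Tendsto (fun n : ℕ => (∑ i ∈ Ico (n / 2 + 1) (n + 1),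
      coeff i (H * H) * (((n - i : ℕ) : ℝ) * coeff (n - i) G)) / ((n : ℝ) * coeff n G))
      atTop (𝓝 0) := by
    refine squeeze_zero' (g := fun n : ℕ => K * D * S / n) ?_ ?_
      (tendsto_const_div_atTop_nhds_zero_nat _)
    · filter_upwards with n
      exact div_nonneg (Finset.sum_nonneg fun i _ => mul_nonneg (hHH0 i) (hV0 _)) (hV0 n)
    · filter_upwards [hDu, eventually_ge_atTop (2 * N), eventually_gt_atTop 0] with n h1 h2 h3
      have hn : (0 : ℝ) < n := by exact_mod_cast h3
      have hgn := (h1 n (by omega)).1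
      have hle : ∑ i ∈ Ico (n / 2 + 1) (n + 1),
          coeff i (H * H) * (((n - i : ℕ) : ℝ) * coeff (n - i) G) ≤ K * D * coeff n G * S := by
        calc _ ≤ ∑ i ∈ Ico (n / 2 + 1) (n + 1),
              K * D * coeff n G * (((n - i : ℕ) : ℝ) * coeff (n - i) G) := by
              refine Finset.sum_le_sum fun i hi => ?_
              have hi' := mem_Ico.1 hi
              refine mul_le_mul_of_nonneg_right ?_ (hV0 _)
              calc _ ≤ K * coeff i G := hN i (by omega)
                _ ≤ K * (D * coeff n G) := by gcongr; exact (h1 i (by omega)).2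
                _ = _ := by ring
          _ ≤ _ := by
              rw [← mul_sum]
              gcongr
              refine sum_range_sub_le_tsum hV0 hGm (n := n) ?_
              intro i hi
              exact mem_range.2 (mem_Ico.1 hi).2
      calc _ ≤ K * D * coeff n G * S / ((n : ℝ) * coeff n G) := by gcongr
        _ = _ := by field_simp
  have hfin := (hT.add hR).mul_const (1 / c)
  rw [add_zero, one_mul] at hfin
  refine hfin.congr' ?_
  filter_upwards [hreg.1, eventually_gt_atTop 0] with n h1 h2
  have hn : (n : ℝ) ≠ 0 := by
    have := h2.ne'
    exact_mod_cast this
  have hid := congrArg (coeff n) (renewal_derivative hH)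
  rw [coeff_mul_C, coeff_mk, coeff_mul_range, sum_range_succ_eq_half_add] at hid
  simp only [coeff_mk] at hid
  rw [← add_div, ← hid]
  field_simp

theorem renewal_hasSum_mean (hc : 0 < c) (hG : ∀ n, 0 ≤ coeff n G)
    (hGs : HasSum (fun n => coeff n G) (1 - c)) (hH : H * (1 - G) = C c) {m : ℝ}
    (hGm : HasSum (fun n : ℕ => (n : ℝ) * coeff n G) m) :
    HasSum (fun n : ℕ => (n : ℝ) * coeff n H) (m / c) := by
  have hH0 := renewal_nonneg hc hG hGs hH
  have hHs := renewal_hasSum hc hG hGs hH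
  have hHH := hasSum_coeff_mul hH0 hH0 hHs hHs
  have hHH0 := coeff_mul_nonneg hH0 hH0
  have h1 := hasSum_coeff_mul (A := H * H) (B := mk fun n => (n : ℝ) * coeff n G) hHH0
    (fun n => by rw [coeff_mk]; exact mul_nonneg n.cast_nonneg (hG n)) hHH (by simpa using hGm)
  rw [← renewal_derivative hH, one_mul, one_mul] at h1
  simp only [coeff_mul_C, coeff_mk] at h1
  have h2 := h1.div_const c
  simpa [mul_div_assoc, hc.ne'] using h2

end Renewal
-- Truncation and exponential bounds
/-- The part of a power series of degree at most `r`. -/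
noncomputable def lowPart (H : ℝ⟦X⟧) (r : ℝ) : ℝ⟦X⟧ := mk fun j => if (j : ℝ) ≤ r then coeff j H else 0

/-- The part of a power series of degree greater than `r`. -/
noncomputable def highPart (H : ℝ⟦X⟧) (r : ℝ) : ℝ⟦X⟧ := mk fun j => if (j : ℝ) ≤ r then 0 else coeff j H

theorem lowPart_add_highPart (H : ℝ⟦X⟧) (r : ℝ) : lowPart H r + highPart H r = H := by
  ext j
  rw [map_add, lowPart, highPart, coeff_mk, coeff_mk]
  split_ifs <;> simp

theorem coeff_pow_nonneg {A : ℝ⟦X⟧} (hA : ∀ n, 0 ≤ coeff n A) (k n : ℕ) : 0 ≤ coeff n (A ^ k) := by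
  induction k generalizing n with
  | zero => rw [pow_zero, coeff_one]; split_ifs <;> norm_num
  | succ k ih => rw [pow_succ]; exact coeff_mul_nonneg ih hA n

theorem hasSum_coeff_pow {A : ℝ⟦X⟧} (hA : ∀ n, 0 ≤ coeff n A) {a : ℝ}
    (ha : HasSum (fun n => coeff n A) a) (k : ℕ) : HasSum (fun n => coeff n (A ^ k)) (a ^ k) := by
  induction k with
  | zero =>
    simp only [pow_zero, coeff_one]
    exact hasSum_ite_eq 0 1
  | succ k ih =>
    rw [pow_succ, pow_succ]
    exact hasSum_coeff_mul (coeff_pow_nonneg hA k) hA ih ha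

theorem coeff_mul_le {A B : ℝ⟦X⟧} (hB : ∀ n, 0 ≤ coeff n B)
    {s t : ℝ} (hs : 0 ≤ s) (hAs : ∀ n, coeff n A ≤ s) (ht : HasSum (fun n => coeff n B) t) (n : ℕ) :
    coeff n (A * B) ≤ s * t := by
  rw [coeff_mul_range]
  calc _ ≤ ∑ i ∈ range (n + 1), s * coeff (n - i) B :=
        Finset.sum_le_sum fun i _ => mul_le_mul_of_nonneg_right (hAs i) (hB _)
    _ = s * ∑ i ∈ range (n + 1), coeff (n - i) B := by rw [mul_sum]
    _ ≤ s * t := by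
        gcongr
        rw [← ht.tsum_eq]
        exact sum_range_sub_le_tsum hB ht.summable (Finset.Subset.refl _)

/-- Chernoff's bound. -/
theorem sum_coeff_pow_le {A : ℝ⟦X⟧} (hA : ∀ n, 0 ≤ coeff n A) {s v : ℝ}
    (hv : HasSum (fun j => coeff j (rescale (Real.exp s) A)) v) (n : ℕ) {t : ℝ} {S : Finset ℕ}
    (hS : ∀ l ∈ S, s * t ≤ s * l) : ∑ l ∈ S, coeff l (A ^ n) ≤ Real.exp (-(s * t)) * v ^ n := by
  have hR : ∀ j, 0 ≤ coeff j (rescale (Real.exp s) A) := fun j => by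
    rw [coeff_rescale]; exact mul_nonneg (by positivity) (hA j)
  have h1 := hasSum_coeff_pow hR hv n
  rw [← map_pow] at h1
  have h2 := sum_le_hasSum S (fun i _ => by
    rw [map_pow]; exact coeff_pow_nonneg hR n i) h1
  calc _ ≤ ∑ l ∈ S, Real.exp (-(s * t)) * coeff l (rescale (Real.exp s) (A ^ n)) := by
        refine Finset.sum_le_sum fun l hl => ?_
        rw [coeff_rescale, ← mul_assoc, ← Real.exp_nat_mul, ← Real.exp_add]
        refine le_mul_of_one_le_left (coeff_pow_nonneg hA n l) (Real.one_le_exp ?_)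
        have := hS l hl
        linarith
    _ = Real.exp (-(s * t)) * ∑ l ∈ S, coeff l (rescale (Real.exp s) (A ^ n)) := by rw [mul_sum]
    _ ≤ _ := by gcongr

/-- The powers of `a + b` split by the number of factors `b`: none, exactly one, at least two. `Q`
collects the last case through `Q_{N+1} = (N + 1) a^N + H Q_N`, and only its mass matters. -/
theorem pow_succ_eq_add_sq_mul {a b H : ℝ⟦X⟧} (hab : a + b = H) (ha : ∀ n, 0 ≤ coeff n a)
    (hH : ∀ n, 0 ≤ coeff n H) {α : ℝ} (hα : HasSum (fun n => coeff n a) α) (hα1 : α ≤ 1)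
    (hHs : HasSum (fun n => coeff n H) 1) (N : ℕ) :
    ∃ Q : ℝ⟦X⟧, H ^ (N + 1) = a ^ (N + 1) + (N + 1 : ℝ⟦X⟧) * (b * a ^ N) + b * (b * Q) ∧
      (∀ n, 0 ≤ coeff n Q) ∧ ∃ q : ℝ, q ≤ ((N : ℝ) + 1) ^ 2 ∧ HasSum (fun n => coeff n Q) q := by
  have hα0 : 0 ≤ α := hα.nonneg ha
  induction N with
  | zero => exact ⟨0, by simp [hab], by simp, 0, by norm_num, by simp⟩
  | succ N ih =>
    obtain ⟨Q, h1, h2, q, h3, h4⟩ := ih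
    refine ⟨C ((N : ℝ) + 1) * a ^ N + H * Q, ?_, ?_, ((N : ℝ) + 1) * α ^ N + 1 * q, ?_, ?_⟩
    · rw [pow_succ, h1, ← hab]
      simp only [map_add, map_natCast, map_one, Nat.cast_add, Nat.cast_one]
      ring
    · intro n
      rw [map_add, coeff_C_mul]
      exact add_nonneg (mul_nonneg (by positivity) (coeff_pow_nonneg ha N n))
        (coeff_mul_nonneg hH h2 n)
    · have : α ^ N ≤ 1 := pow_le_one₀ hα0 hα1
      have h5 : ((N : ℝ) + 1) * α ^ N ≤ ((N : ℝ) + 1) * 1 := by gcongr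
      push_cast
      nlinarith [(Nat.cast_nonneg N : (0 : ℝ) ≤ N)]
    · have e : (fun n => coeff n (C ((N : ℝ) + 1) * a ^ N + H * Q)) =
          fun n => ((N : ℝ) + 1) * coeff n (a ^ N) + coeff n (H * Q) := by
        funext n
        rw [(coeff n).map_add, coeff_C_mul]
      rw [e]
      exact ((hasSum_coeff_pow ha hα N).mul_left _).add (hasSum_coeff_mul hH h2 hHs h4)

/-! ### One big jump -/

section BigJump

variable {H : ℝ⟦X⟧} {m : ℝ}

theorem lowPart_nonneg (hH0 : ∀ n, 0 ≤ coeff n H) (r : ℝ) (j : ℕ) : 0 ≤ coeff j (lowPart H r) := by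
  rw [lowPart, coeff_mk]; split_ifs <;> simp [hH0]

theorem lowPart_le (hH0 : ∀ n, 0 ≤ coeff n H) (r : ℝ) (j : ℕ) :
    coeff j (lowPart H r) ≤ coeff j H := by
  rw [lowPart, coeff_mk]; split_ifs <;> simp [hH0]

theorem highPart_nonneg (hH0 : ∀ n, 0 ≤ coeff n H) (r : ℝ) (j : ℕ) : 0 ≤ coeff j (highPart H r) := by
  rw [highPart, coeff_mk]; split_ifs <;> simp [hH0]

theorem highPart_le (hH0 : ∀ n, 0 ≤ coeff n H) (r : ℝ) (j : ℕ) :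
    coeff j (highPart H r) ≤ coeff j H := by
  rw [highPart, coeff_mk]; split_ifs <;> simp [hH0]

theorem tendsto_rpow_mul_log_div {C δ a : ℝ} (hC : 0 ≤ C) (ha : 0 < a) (hCδ : C * δ < a) :
    Tendsto (fun n : ℕ => (n : ℝ) ^ (C * δ) * (C * Real.log n / n) ^ a) atTop (𝓝 0) := by
  have hpos : 0 < 1 - C * δ / a := by
    rw [sub_pos, div_lt_one ha]; exact hCδ
  have h1 : Tendsto (fun n : ℕ => C * (Real.log n / (n : ℝ) ^ (1 - C * δ / a))) atTop (𝓝 (C * 0)) :=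
    ((isLittleO_log_rpow_atTop hpos).tendsto_div_nhds_zero.comp
      tendsto_natCast_atTop_atTop).const_mul C
  rw [mul_zero] at h1
  have h2 := h1.rpow_const (p := a) (Or.inr ha.le)
  rw [Real.zero_rpow ha.ne'] at h2
  refine h2.congr' ?_
  filter_upwards [eventually_ge_atTop 1] with n hn
  have hn0 : (0 : ℝ) < n := by exact_mod_cast hn
  have e : C * (Real.log n / (n : ℝ) ^ (1 - C * δ / a)) =
      (n : ℝ) ^ (C * δ / a) * (C * Real.log n / n) := by
    rw [Real.rpow_sub hn0, Real.rpow_one]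
    field_simp
  rw [e]
  rw [Real.mul_rpow (by positivity) (by positivity), ← Real.rpow_mul hn0.le,
    div_mul_cancel₀ _ ha.ne']

/-- With tilt `s = C log n / n`, use `exp (s j) ≤ 1 + exp τ * s j` where `s j ≤ τ`. Otherwise `j ≤ δ
n` gives `exp (s j) ≤ n ^ (C δ)`, and the moment of order `1 + a` pays the factor `(s j / τ) ^ (1 +
a)`. The condition `C * δ < a` makes this second part `o(s)`. -/
theorem eventually_exp_moment_lowPart (hH0 : ∀ n, 0 ≤ coeff n H)
    (hHs : HasSum (fun n => coeff n H) 1) (hHm : HasSum (fun n : ℕ => (n : ℝ) * coeff n H) m)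
    {a : ℝ} (ha : 0 < a) (hB : Summable fun n : ℕ => (n : ℝ) ^ (1 + a) * coeff n H)
    {C δ : ℝ} (hC : 0 < C) (hCδ : C * δ < a) {ε : ℝ} (hε : 0 < ε) :
    ∀ᶠ n : ℕ in atTop, ∃ v, HasSum (fun j => coeff j
      (rescale (Real.exp (C * Real.log n / n)) (lowPart H (δ * n)))) v ∧
      v ≤ 1 + C * Real.log n / n * (m + ε) := by
  have hm0 : 0 ≤ m := hHm.nonneg fun n => mul_nonneg n.cast_nonneg (hH0 n)
  obtain ⟨τ, hτ0, hτ⟩ : ∃ τ : ℝ, 0 < τ ∧ Real.exp τ * m ≤ m + ε / 2 := by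
    have h1 : Tendsto (fun τ => Real.exp τ * m) (𝓝 0) (𝓝 (Real.exp 0 * m)) :=
      (Real.continuous_exp.mul continuous_const).tendsto 0
    rw [Real.exp_zero, one_mul] at h1
    have h2 := h1.eventually (gt_mem_nhds (by linarith : m < m + ε / 2))
    obtain ⟨τ, h3, h4⟩ := (((h2.filter_mono nhdsWithin_le_nhds).and
      (self_mem_nhdsWithin (s := Set.Ioi (0 : ℝ))))).exists
    exact ⟨τ, h4, h3.le⟩
  set B := ∑' n : ℕ, (n : ℝ) ^ (1 + a) * coeff n H with hBdef
  have hB0 : 0 ≤ B := tsum_nonneg fun n => mul_nonneg (by positivity) (hH0 n)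
  have hlim := (tendsto_rpow_mul_log_div hC.le ha hCδ).mul_const (τ ^ (-(1 + a)) * B)
  rw [zero_mul] at hlim
  filter_upwards [hlim.eventually (gt_mem_nhds (half_pos hε)), eventually_gt_atTop 1] with n h1 h2
  have hn : (0 : ℝ) < n := by
    have : 0 < n := by omega
    exact_mod_cast this
  have hlog : 0 < Real.log n := Real.log_pos (by exact_mod_cast h2)
  set s := C * Real.log n / n with hs
  have hs0 : 0 < s := by positivity
  have hsn : s * n = C * Real.log n := by rw [hs]; field_simp
  set D := (n : ℝ) ^ (C * δ) * (s / τ) ^ (1 + a) with hD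
  have hD0 : 0 ≤ D := by positivity
  have hbound : ∀ j : ℕ, coeff j (rescale (Real.exp s) (lowPart H (δ * n))) ≤
      coeff j H + Real.exp τ * s * (j * coeff j H) + D * ((j : ℝ) ^ (1 + a) * coeff j H) := by
    intro j
    have hj0 := hH0 j
    rw [coeff_rescale, lowPart, coeff_mk]
    split_ifs with hj
    · have key : Real.exp (s * j) ≤ 1 + Real.exp τ * (s * j) + D * (j : ℝ) ^ (1 + a) := by
        by_cases hjτ : s * j ≤ τ
        · have e1 : Real.exp (s * j) ≤ 1 + s * j * Real.exp (s * j) := by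
            have := Real.add_one_le_exp (-(s * j))
            rw [Real.exp_neg] at this
            have hp := Real.exp_pos (s * j)
            have h3 : (-(s * j) + 1) * Real.exp (s * j) ≤ 1 := by
              calc _ ≤ (Real.exp (s * j))⁻¹ * Real.exp (s * j) := by gcongr
                _ = 1 := inv_mul_cancel₀ hp.ne'
            linarith
          have e2 : s * j * Real.exp (s * j) ≤ s * j * Real.exp τ := by gcongr
          have e3 : 0 ≤ D * (j : ℝ) ^ (1 + a) := by positivity
          linarith
        · push Not at hjτ
          have e1 : Real.exp (s * j) ≤ (n : ℝ) ^ (C * δ) := by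
            rw [Real.rpow_def_of_pos hn]
            refine Real.exp_le_exp.2 ?_
            calc s * j ≤ s * (δ * n) := by gcongr
              _ = s * n * δ := by ring
              _ = _ := by rw [hsn]; ring
          have e2 : 1 ≤ (s / τ) ^ (1 + a) * (j : ℝ) ^ (1 + a) := by
            rw [← Real.mul_rpow (by positivity) (by positivity)]
            refine Real.one_le_rpow ?_ (by linarith)
            rw [div_mul_eq_mul_div, one_le_div hτ0]
            exact hjτ.le
          have e3 : (n : ℝ) ^ (C * δ) ≤ D * (j : ℝ) ^ (1 + a) := by
            rw [hD, mul_assoc]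
            exact le_mul_of_one_le_right (by positivity) e2
          have e4 : 0 ≤ Real.exp τ * (s * j) := by positivity
          linarith
      rw [← Real.exp_nat_mul, mul_comm (j : ℝ) s]
      calc _ ≤ (1 + Real.exp τ * (s * j) + D * (j : ℝ) ^ (1 + a)) * coeff j H := by gcongr
        _ = _ := by ring
    · rw [mul_zero]
      positivity
  have hsumR := (hHs.add (hHm.mul_left (Real.exp τ * s))).add (hB.hasSum.mul_left D)
  have hnn : ∀ j, 0 ≤ coeff j (rescale (Real.exp s) (lowPart H (δ * n))) := fun j => by
    rw [coeff_rescale]; exact mul_nonneg (by positivity) (lowPart_nonneg hH0 _ _)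
  have hsum := Summable.of_nonneg_of_le hnn hbound hsumR.summable
  refine ⟨_, hsum.hasSum, (hasSum_le hbound hsum.hasSum hsumR).trans ?_⟩
  have e1 : Real.exp τ * s * m ≤ s * (m + ε / 2) := by
    calc _ = s * (Real.exp τ * m) := by ring
      _ ≤ _ := by gcongr
  have e2 : D * B ≤ s * (ε / 2) := by
    have e3 : D * B = s * ((n : ℝ) ^ (C * δ) * s ^ a * (τ ^ (-(1 + a)) * B)) := by
      rw [hD, Real.div_rpow hs0.le hτ0.le, Real.rpow_add hs0, Real.rpow_one, Real.rpow_neg hτ0.le]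
      field_simp
    rw [e3]
    gcongr
  linarith


/-- Chernoff's bound at the tilt `C log n / n`: without large steps, exceeding the mean has
polynomially small probability, of arbitrary degree through `C`. Allowing `k = n + 1` costs one
extra factor, absorbed by `m + ε ≤ n * ε`. -/
theorem eventually_sum_lowPart_pow_le (hH0 : ∀ n, 0 ≤ coeff n H)
    (hHs : HasSum (fun n => coeff n H) 1) (hHm : HasSum (fun n : ℕ => (n : ℝ) * coeff n H) m)
    {a : ℝ} (ha : 0 < a) (hB : Summable fun n : ℕ => (n : ℝ) ^ (1 + a) * coeff n H)
    {C δ : ℝ} (hC : 0 < C) (hCδ : C * δ < a) {ρ : ℝ} (hρ : m < ρ) :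
    ∀ᶠ n : ℕ in atTop, ∀ k ≤ n + 1, ∀ S : Finset ℕ, (∀ l ∈ S, ρ * n ≤ l) →
      ∑ l ∈ S, coeff l (lowPart H (δ * n) ^ k) ≤ (n : ℝ) ^ (-(C * (ρ - m) / 2)) := by
  have hm0 : 0 ≤ m := hHm.nonneg fun n => mul_nonneg n.cast_nonneg (hH0 n)
  set ε := (ρ - m) / 4 with hε
  have hε0 : 0 < ε := by rw [hε]; linarith
  have hbig : ∀ᶠ n : ℕ in atTop, m + ε ≤ n * ε :=
    (tendsto_natCast_atTop_atTop.atTop_mul_const hε0).eventually_ge_atTop _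
  filter_upwards [eventually_exp_moment_lowPart hH0 hHs hHm ha hB hC hCδ hε0, hbig,
    eventually_gt_atTop 1] with n hn hn2 hn1 k hk S hS
  obtain ⟨v, hv, hv1⟩ := hn
  have hn0 : (0 : ℝ) < n := by
    have : 0 < n := by omega
    exact_mod_cast this
  have hlog : 0 < Real.log n := Real.log_pos (by exact_mod_cast hn1)
  set s := C * Real.log n / n with hs
  have hs0 : 0 < s := by positivity
  have hsn : s * n = C * Real.log n := by rw [hs]; field_simp
  have hv0 : 0 ≤ v := hv.nonneg fun j => by
    rw [coeff_rescale]; exact mul_nonneg (by positivity) (lowPart_nonneg hH0 _ _)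
  have h1 := sum_coeff_pow_le (lowPart_nonneg hH0 (δ * n)) hv k (t := ρ * n) (S := S)
    (fun l hl => by gcongr; exact hS l hl)
  have hk' : (k : ℝ) ≤ n + 1 := by exact_mod_cast hk
  have h2 : v ^ k ≤ Real.exp (s * n * (m + 2 * ε)) := by
    calc v ^ k ≤ Real.exp (s * (m + ε)) ^ k := by
          gcongr
          refine hv1.trans ?_
          have := Real.add_one_le_exp (s * (m + ε))
          linarith
      _ = Real.exp (k * (s * (m + ε))) := by rw [← Real.exp_nat_mul]
      _ ≤ _ := by
          refine Real.exp_le_exp.2 ?_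
          calc _ ≤ (n + 1) * (s * (m + ε)) := by gcongr
            _ = s * (n * (m + ε) + (m + ε)) := by ring
            _ ≤ s * (n * (m + ε) + n * ε) := by gcongr
            _ = _ := by ring
  refine h1.trans ?_
  calc _ ≤ Real.exp (-(s * (ρ * n))) * Real.exp (s * n * (m + 2 * ε)) := by gcongr
    _ = Real.exp (-(s * n * ((ρ - m) / 2))) := by
        rw [← Real.exp_add, hε]; congr 1; ring
    _ = _ := by
        rw [hsn, Real.rpow_def_of_pos hn0]; congr 1; ring

/-- Lower deviations of nonnegative variables are exponentially small even without upper exponential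
moments. The base `x` must serve all `A` below `H`, since the truncation level varies with `n`. -/
theorem exists_sum_pow_le_pow (hH0 : ∀ n, 0 ≤ coeff n H)
    (hHs : HasSum (fun n => coeff n H) 1) (hHm : HasSum (fun n : ℕ => (n : ℝ) * coeff n H) m)
    {ρ : ℝ} (hρ : ρ < m) :
    ∃ x : ℝ, 0 ≤ x ∧ x < 1 ∧ ∀ A : ℝ⟦X⟧, (∀ j, 0 ≤ coeff j A) → (∀ j, coeff j A ≤ coeff j H) →
      ∀ (n : ℕ) (S : Finset ℕ), (∀ l ∈ S, (l : ℝ) ≤ ρ * n) → ∑ l ∈ S, coeff l (A ^ n) ≤ x ^ n := by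
  obtain ⟨K, hK⟩ : ∃ K : Finset ℕ, ρ < ∑ j ∈ K, (j : ℝ) * coeff j H :=
    (hHm.eventually (lt_mem_nhds hρ)).exists
  -- Tilting only the finitely many degrees in `K` makes the derivative at `0` elementary; it is
  -- negative by the choice of `K`, which yields a useful `s > 0`.
  set f : ℝ → ℝ := fun s =>
    1 - ∑ j ∈ K, coeff j H * (1 - Real.exp (-s * j)) - Real.exp (-s * ρ) with hf
  have hf0 : f 0 = 0 := by simp [hf]
  have hexp : ∀ c : ℝ, HasDerivAt (fun s : ℝ => Real.exp (-s * c)) (-c) 0 := by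
    intro c
    have h1 : HasDerivAt (fun s : ℝ => -s * c) (-1 * c) 0 := (hasDerivAt_id (0 : ℝ)).neg.mul_const c
    simpa using h1.exp
  have hfd : HasDerivAt f (-(∑ j ∈ K, coeff j H * j) + ρ) 0 := by
    have h1 : HasDerivAt (fun s : ℝ => ∑ j ∈ K, coeff j H * (1 - Real.exp (-s * j)))
        (∑ j ∈ K, coeff j H * j) 0 := by
      refine HasDerivAt.fun_sum fun j _ => ?_
      have := ((hexp j).const_sub 1).const_mul (coeff j H)
      simpa using this
    have h2 : HasDerivAt f (-(∑ j ∈ K, coeff j H * j) - -ρ) 0 := (h1.const_sub 1).sub (hexp ρ)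
    rwa [sub_neg_eq_add] at h2
  have hneg : -(∑ j ∈ K, coeff j H * j) + ρ < 0 := by
    simp only [mul_comm (coeff _ H)]
    linarith
  obtain ⟨s, hs, hs0⟩ : ∃ s, f s < 0 ∧ 0 < s := by
    have h1 := (hasDerivAt_iff_tendsto_slope.1 hfd).eventually (gt_mem_nhds hneg)
    have hsub : Set.Ioi (0 : ℝ) ⊆ {0}ᶜ := fun x hx => ne_of_gt hx
    have h2 := h1.filter_mono (nhdsWithin_mono 0 hsub)
    obtain ⟨s, h3, h4⟩ := (h2.and (self_mem_nhdsWithin (s := Set.Ioi (0 : ℝ)))).exists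
    refine ⟨s, ?_, h4⟩
    rw [slope_def_field, hf0, sub_zero, sub_zero] at h3
    by_contra hcon
    exact absurd h3 (not_lt.2 (div_nonneg (not_lt.1 hcon) (le_of_lt h4)))
  set v := 1 - ∑ j ∈ K, coeff j H * (1 - Real.exp (-s * j)) with hv
  have hv0 : HasSum (fun j => coeff j H -
      if j ∈ K then coeff j H * (1 - Real.exp (-s * j)) else 0) v := by
    refine hHs.sub ?_
    have : ∑ j ∈ K, coeff j H * (1 - Real.exp (-s * j)) =
        ∑ j ∈ K, if j ∈ K then coeff j H * (1 - Real.exp (-s * j)) else 0 :=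
      Finset.sum_congr rfl fun j hj => by rw [if_pos hj]
    rw [this]
    exact hasSum_sum_of_ne_finset_zero fun j hj => by rw [if_neg hj]
  have hbd : ∀ j, coeff j (rescale (Real.exp (-s)) H) ≤ coeff j H -
      if j ∈ K then coeff j H * (1 - Real.exp (-s * j)) else 0 := by
    intro j
    rw [coeff_rescale, ← Real.exp_nat_mul, mul_comm (j : ℝ)]
    split_ifs
    · exact le_of_eq (by ring)
    · rw [sub_zero]
      refine mul_le_of_le_one_left (hH0 j) (Real.exp_le_one_iff.2 ?_)
      have : 0 ≤ s * j := by positivity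
      linarith
  have hnnH : ∀ j, 0 ≤ coeff j (rescale (Real.exp (-s)) H) := fun j => by
    rw [coeff_rescale]; exact mul_nonneg (by positivity) (hH0 j)
  have hvnn : 0 ≤ v := hv0.nonneg fun j => (hnnH j).trans (hbd j)
  refine ⟨Real.exp (s * ρ) * v, by positivity, ?_, ?_⟩
  · have h1 : v < Real.exp (-s * ρ) := by
      have : f s = v - Real.exp (-s * ρ) := rfl
      linarith
    calc Real.exp (s * ρ) * v < Real.exp (s * ρ) * Real.exp (-s * ρ) := by gcongr
      _ = 1 := by rw [← Real.exp_add]; simp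
  · intro A hA0 hAH n S hS
    have hnn : ∀ j, 0 ≤ coeff j (rescale (Real.exp (-s)) A) := fun j => by
      rw [coeff_rescale]; exact mul_nonneg (by positivity) (hA0 j)
    have hle : ∀ j, coeff j (rescale (Real.exp (-s)) A) ≤ coeff j H -
        if j ∈ K then coeff j H * (1 - Real.exp (-s * j)) else 0 := fun j => by
      refine le_trans ?_ (hbd j)
      rw [coeff_rescale, coeff_rescale]
      gcongr
      exact hAH j
    have hsum := Summable.of_nonneg_of_le hnn hle hv0.summable
    have h1 := sum_coeff_pow_le hA0 hsum.hasSum n (t := ρ * n) (S := S) (fun l hl => by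
      have := mul_le_mul_of_nonneg_left (hS l hl) hs0.le
      linarith)
    refine h1.trans ?_
    rw [mul_pow, ← Real.exp_nat_mul]
    have h2 : ∑' j, coeff j (rescale (Real.exp (-s)) A) ≤ v := hasSum_le hle hsum.hasSum hv0
    have h3 : 0 ≤ ∑' j, coeff j (rescale (Real.exp (-s)) A) := tsum_nonneg hnn
    have e : -(-s * (ρ * n)) = n * (s * ρ) := by ring
    rw [e]
    gcongr

theorem summable_highPart (hH0 : ∀ n, 0 ≤ coeff n H)
    (hHs : HasSum (fun n => coeff n H) 1) (r : ℝ) : Summable fun j => coeff j (highPart H r) :=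
  Summable.of_nonneg_of_le (highPart_nonneg hH0 r) (highPart_le hH0 r) hHs.summable

/-- A finite mean forces `n * P(X > δ n) → 0`, by Markov's inequality on the tail of the mean. -/
theorem tendsto_mul_tsum_highPart (hH0 : ∀ n, 0 ≤ coeff n H)
    (hHs : HasSum (fun n => coeff n H) 1) (hHm : HasSum (fun n : ℕ => (n : ℝ) * coeff n H) m)
    {δ : ℝ} (hδ : 0 < δ) :
    Tendsto (fun n : ℕ => ((n : ℝ) + 1) * ∑' j, coeff j (highPart H (δ * n))) atTop (𝓝 0) := by
  have h1 : Tendsto (fun n : ℕ => ∑' j : ℕ, (j : ℝ) * coeff j (highPart H (δ * n))) atTop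
      (𝓝 (∑' _ : ℕ, (0 : ℝ))) := by
    refine tendsto_tsum_of_dominated_convergence hHm.summable ?_ ?_
    · intro j
      refine tendsto_const_nhds.congr' ?_
      have : ∀ᶠ n : ℕ in atTop, (j : ℝ) ≤ δ * n :=
        (tendsto_natCast_atTop_atTop.const_mul_atTop hδ).eventually_ge_atTop _
      filter_upwards [this] with n hn
      rw [highPart, coeff_mk, if_pos hn, mul_zero]
    · filter_upwards with n j
      rw [Real.norm_eq_abs, abs_of_nonneg (mul_nonneg j.cast_nonneg (highPart_nonneg hH0 _ _))]
      gcongr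
      exact highPart_le hH0 _ _
  rw [tsum_zero] at h1
  have h2 := h1.const_mul (2 / δ)
  rw [mul_zero] at h2
  refine squeeze_zero' ?_ ?_ h2
  · filter_upwards with n
    exact mul_nonneg (by positivity) (tsum_nonneg fun j => highPart_nonneg hH0 _ _)
  · filter_upwards [eventually_ge_atTop 1] with n hn
    have hn0 : (1 : ℝ) ≤ n := by exact_mod_cast hn
    have hs : Summable fun j : ℕ => (j : ℝ) * coeff j (highPart H (δ * n)) :=
      Summable.of_nonneg_of_le (fun j => mul_nonneg j.cast_nonneg (highPart_nonneg hH0 _ _))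
        (fun j => by gcongr; exact highPart_le hH0 _ _) hHm.summable
    rw [← tsum_mul_left, ← tsum_mul_left]
    refine Summable.tsum_le_tsum (fun j => ?_) ((summable_highPart hH0 hHs _).mul_left _)
      (hs.mul_left _)
    rw [highPart, coeff_mk]
    split_ifs with hj
    · simp
    · push Not at hj
      have hj0 := hH0 j
      rw [← mul_assoc]
      gcongr
      calc (n : ℝ) + 1 ≤ 2 * n := by linarith
        _ = 2 / δ * (δ * n) := by field_simp
        _ ≤ _ := by gcongr

theorem hasSum_lowPart (hH0 : ∀ n, 0 ≤ coeff n H)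
    (hHs : HasSum (fun n => coeff n H) 1) (r : ℝ) :
    HasSum (fun j => coeff j (lowPart H r)) (1 - ∑' j, coeff j (highPart H r)) := by
  have e : (fun j => coeff j (lowPart H r)) = fun j => coeff j H - coeff j (highPart H r) := by
    funext j
    rw [eq_sub_iff_add_eq, ← (coeff j).map_add, lowPart_add_highPart]
  rw [e]
  exact hHs.sub (summable_highPart hH0 hHs r).hasSum

/-- A weak law of large numbers for truncated steps. The mass lost to truncation is controlled by
Bernoulli's inequality, and the two tails by the preceding deviation bounds. -/
theorem eventually_le_sum_near (hH0 : ∀ n, 0 ≤ coeff n H)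
    (hHs : HasSum (fun n => coeff n H) 1) (hHm : HasSum (fun n : ℕ => (n : ℝ) * coeff n H) m)
    {a : ℝ} (ha : 0 < a) (hB : Summable fun n : ℕ => (n : ℝ) ^ (1 + a) * coeff n H)
    {C δ : ℝ} (hC : 0 < C) (hδ : 0 < δ) (hCδ : C * δ < a) {ε : ℝ} (hε : 0 < ε) (hε1 : m + ε < 1)
    {η : ℝ} (hη : 0 < η) :
    ∀ᶠ n : ℕ in atTop, 1 - η ≤ ∑ l ∈ (range (n + 1)).filter (fun l : ℕ => |(l : ℝ) - m * n| ≤ ε * n),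
      coeff l (lowPart H (δ * n) ^ n) := by
  obtain ⟨x, hx0, hx1, hx⟩ := exists_sum_pow_le_pow hH0 hHs hHm (ρ := m - ε) (by linarith)
  have h1 := (tendsto_pow_atTop_nhds_zero_of_lt_one hx0 hx1).eventually
    (gt_mem_nhds (by positivity : 0 < η / 4))
  have h2 := eventually_sum_lowPart_pow_le hH0 hHs hHm ha hB hC hCδ (ρ := m + ε) (by linarith)
  have h3 := ((tendsto_rpow_neg_atTop (y := C * (m + ε - m) / 2) (by rw [add_sub_cancel_left]; positivity)).comp
    tendsto_natCast_atTop_atTop).eventually (gt_mem_nhds (by positivity : 0 < η / 4))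
  have h4 := (tendsto_mul_tsum_highPart hH0 hHs hHm hδ).eventually
    (gt_mem_nhds (by positivity : 0 < η / 4))
  filter_upwards [h1, h2, h3, h4] with n h1 h2 h3 h4
  set A := lowPart H (δ * n) with hA
  have hA0 : ∀ j, 0 ≤ coeff j A := lowPart_nonneg hH0 _
  have hAp := coeff_pow_nonneg hA0 n
  set t := ∑' j, coeff j (highPart H (δ * n)) with ht
  have ht0 : 0 ≤ t := tsum_nonneg fun j => highPart_nonneg hH0 _ _
  have hAs := hasSum_lowPart hH0 hHs (δ * n)
  have hAn := hasSum_coeff_pow hA0 hAs n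
  have ht1 : 0 ≤ 1 - t := hAs.nonneg hA0
  have hbern : 1 - η / 4 ≤ (1 - t) ^ n := by
    have := one_add_mul_le_pow (a := -t) (by linarith) n
    rw [← sub_eq_add_neg] at this
    refine le_trans ?_ this
    linarith
  obtain ⟨S, hS⟩ := (hAn.eventually (lt_mem_nhds (by linarith : (1 - t) ^ n - η / 4 < (1 - t) ^ n))).exists
  have e1 := hx A hA0 (lowPart_le hH0 _) n (S.filter fun l : ℕ => (l : ℝ) ≤ (m - ε) * n)
    (fun l hl => (mem_filter.1 hl).2)
  have e2 := h2 n (by omega) (S.filter fun l : ℕ => (m + ε) * n ≤ (l : ℝ))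
    (fun l hl => (mem_filter.1 hl).2)
  have hcover : S ⊆ ((range (n + 1)).filter (fun l : ℕ => |(l : ℝ) - m * n| ≤ ε * n)) ∪
      ((S.filter fun l : ℕ => (l : ℝ) ≤ (m - ε) * n) ∪
        (S.filter fun l : ℕ => (m + ε) * n ≤ (l : ℝ))) := by
    intro l hl
    simp only [mem_union, mem_filter, mem_range]
    by_cases c1 : (l : ℝ) ≤ (m - ε) * n
    · exact Or.inr (Or.inl ⟨hl, c1⟩)
    by_cases c2 : (m + ε) * n ≤ (l : ℝ)
    · exact Or.inr (Or.inr ⟨hl, c2⟩)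
    push Not at c1 c2
    refine Or.inl ⟨?_, abs_le.2 ⟨by linarith, by linarith⟩⟩
    have : (l : ℝ) < n + 1 := by
      have : (m + ε) * n ≤ 1 * n := by gcongr
      linarith
    exact_mod_cast this
  have hunion : ∀ s t : Finset ℕ, ∑ l ∈ s ∪ t, coeff l (A ^ n) ≤
      ∑ l ∈ s, coeff l (A ^ n) + ∑ l ∈ t, coeff l (A ^ n) := by
    intro s t
    rw [← sum_union_inter]
    exact le_add_of_nonneg_right (Finset.sum_nonneg fun l _ => hAp l)
  have e3 := (sum_le_sum_of_subset_of_nonneg hcover fun l _ _ => hAp l).trans (hunion _ _)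
  have e4 := hunion (S.filter fun l : ℕ => (l : ℝ) ≤ (m - ε) * n)
    (S.filter fun l : ℕ => (m + ε) * n ≤ (l : ℝ))
  simp only [Function.comp_apply] at h3
  linarith


theorem summable_rpow_mul {β : ℝ} (hβ : 2 < β) {u : ℕ → ℝ} (hreg : RegVar u β) {a : ℝ}
    (ha : 2 + a < β) : Summable fun n : ℕ => (n : ℝ) ^ (1 + a) * u n := by
  obtain ⟨K, hK, h⟩ := hreg.exists_le_rpow (by linarith) (b := (2 + a + β) / 2) (by linarith)
  refine Summable.of_norm_bounded_eventually_nat (g := fun n : ℕ => K * (n : ℝ) ^ (1 + a - (2 + a + β) / 2))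
    ((Real.summable_nat_rpow.2 (by linarith)).mul_left K) ?_
  filter_upwards [h, hreg.1, eventually_gt_atTop 0] with n h1 h2 h3
  have hn : (0 : ℝ) < n := by exact_mod_cast h3
  rw [Real.norm_eq_abs, abs_of_nonneg (by positivity)]
  calc _ ≤ (n : ℝ) ^ (1 + a) * (K * (n : ℝ) ^ (-((2 + a + β) / 2))) := by gcongr
    _ = K * ((n : ℝ) ^ (1 + a) * (n : ℝ) ^ (-((2 + a + β) / 2))) := by ring
    _ = _ := by rw [← Real.rpow_add hn]; rfl

/-- The `n` small steps sum to about `m n`, so the large one has size about `(1 - m) n`, where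
regular variation gives the ratio. Atypical sums carry mass at most `η`, and a large step has
probability at most `D * coeff n H`. -/
theorem tendsto_coeff_highPart_mul_pow (hH0 : ∀ n, 0 ≤ coeff n H)
    (hHs : HasSum (fun n => coeff n H) 1) (hHm : HasSum (fun n : ℕ => (n : ℝ) * coeff n H) m)
    (hm1 : m < 1) {β : ℝ} (hβ : 0 < β) (hreg : RegVar (fun n => coeff n H) β)
    {a : ℝ} (ha : 0 < a) (hB : Summable fun n : ℕ => (n : ℝ) ^ (1 + a) * coeff n H)
    {C δ : ℝ} (hC : 0 < C) (hδ : 0 < δ) (hCδ : C * δ < a) (hδm : δ ≤ (1 - m) / 2) :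
    Tendsto (fun n => coeff n (highPart H (δ * n) * lowPart H (δ * n) ^ n) / coeff n H) atTop
      (𝓝 ((1 - m) ^ (-β))) := by
  set θ := 1 - m with hθ
  have hθ0 : 0 < θ := by rw [hθ]; linarith
  set y := θ ^ (-β) with hy
  have hy0 : 0 < y := Real.rpow_pos_of_pos hθ0 _
  obtain ⟨D, hD0, hD⟩ := hreg.exists_le_mul hβ hδ
  rw [Metric.tendsto_nhds]
  intro e he
  set η := e / (2 * (1 + D + y)) with hη
  have hη0 : 0 < η := by positivity
  have hηe : η * (1 + D + y) < e := by
    have : η * (1 + D + y) = e / 2 := by rw [hη]; field_simp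
    linarith
  obtain ⟨ε, hε0, hε1, hε⟩ : ∃ ε : ℝ, 0 < ε ∧ ε ≤ θ / 4 ∧
      ∀ q : ℝ, |q - θ| ≤ ε → |q ^ (-β) - y| ≤ η / 2 := by
    have hc : ContinuousAt (fun q : ℝ => q ^ (-β)) θ :=
      Real.continuousAt_rpow_const _ _ (Or.inl hθ0.ne')
    obtain ⟨ε, h1, h2⟩ := Metric.continuousAt_iff.1 hc (η / 2) (half_pos hη0)
    refine ⟨min (ε / 2) (θ / 4), by positivity, min_le_right _ _, fun q hq => ?_⟩
    refine (h2 (x := q) ?_).le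
    rw [Real.dist_eq]
    exact (hq.trans (min_le_left _ _)).trans_lt (half_lt_self h1)
  have hε2 : m + ε < 1 := by linarith
  filter_upwards [hreg.1, hD, hreg.2 (θ / 2) (2 * θ) (half_pos hθ0) (η / 2) (half_pos hη0),
    eventually_le_sum_near hH0 hHs hHm ha hB hC hδ hCδ hε0 hε2 hη0, eventually_gt_atTop 0]
    with n hpos hDn hreg1 hnear hn
  have hn0 : (0 : ℝ) < n := by exact_mod_cast hn
  set A := lowPart H (δ * n) with hA
  set B := highPart H (δ * n) with hBdef
  have hA0 : ∀ j, 0 ≤ coeff j A := lowPart_nonneg hH0 _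
  have hB0 : ∀ j, 0 ≤ coeff j B := highPart_nonneg hH0 _
  have hAp := coeff_pow_nonneg hA0 n
  have hAs := hasSum_lowPart hH0 hHs (δ * n)
  have hAn := hasSum_coeff_pow hA0 hAs n
  have hA1 : 1 - ∑' j, coeff j B ≤ 1 := by
    have : 0 ≤ ∑' j, coeff j B := tsum_nonneg hB0
    linarith
  have htot : ∀ S : Finset ℕ, ∑ l ∈ S, coeff l (A ^ n) ≤ 1 := fun S =>
    (sum_le_hasSum S (fun l _ => hAp l) hAn).trans (pow_le_one₀ (hAs.nonneg hA0) hA1)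
  set N := (range (n + 1)).filter (fun l : ℕ => |(l : ℝ) - m * n| ≤ ε * n) with hN
  set F := (range (n + 1)).filter (fun l : ℕ => ¬ |(l : ℝ) - m * n| ≤ ε * n) with hF
  have hsplit : ∀ f : ℕ → ℝ, ∑ l ∈ range (n + 1), f l = ∑ l ∈ N, f l + ∑ l ∈ F, f l := fun f =>
    (sum_filter_add_sum_filter_not _ _ _).symm
  have hFle : ∑ l ∈ F, coeff l (A ^ n) ≤ η := by
    have h1 := htot (range (n + 1))
    rw [hsplit] at h1
    linarith
  have hBle : ∀ j, coeff j B / coeff n H ≤ D := by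
    intro j
    rw [div_le_iff₀ hpos, hBdef, highPart, coeff_mk]
    split_ifs with hj
    · positivity
    · exact hDn j (not_le.1 hj).le
  have hNclose : ∀ l ∈ N, |coeff (n - l) B / coeff n H - y| ≤ η := by
    intro l hl
    obtain ⟨hl1, hl2⟩ := mem_filter.1 hl
    have hln : l ≤ n := by have := mem_range.1 hl1; omega
    have hcast : ((n - l : ℕ) : ℝ) = n - l := Nat.cast_sub hln
    obtain ⟨hl3, hl4⟩ := abs_le.1 hl2
    have hεn : ε * n ≤ θ / 4 * n := by gcongr
    have hθn : 0 < θ * n := by positivity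
    have hmn : m * n = n - θ * n := by rw [hθ]; ring
    -- Here `δ ≤ (1 - m) / 2` matters: the required step lies above the truncation level, so `B` and
    -- `H` agree there.
    have hj : ¬ ((n - l : ℕ) : ℝ) ≤ δ * n := by
      rw [hcast, not_le]
      have : δ * n ≤ θ / 2 * n := by gcongr
      linarith
    have h1 := hreg1 (n - l) (by rw [hcast]; linarith) (by rw [hcast]; linarith)
    have h2 := hε (((n - l : ℕ) : ℝ) / n) (by
      have e1 : ((n - l : ℕ) : ℝ) / n - θ = -((l : ℝ) - m * n) / n := by
        rw [hcast, hmn]; field_simp; ring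
      rw [e1, abs_div, abs_neg, abs_of_pos hn0, div_le_iff₀ hn0]
      exact hl2)
    have h3 : |coeff (n - l) H / coeff n H - (((n - l : ℕ) : ℝ) / n) ^ (-β)| ≤ η / 2 := by
      have e1 : coeff (n - l) H / coeff n H - (((n - l : ℕ) : ℝ) / n) ^ (-β) =
          (coeff (n - l) H - (((n - l : ℕ) : ℝ) / n) ^ (-β) * coeff n H) / coeff n H := by
        field_simp
      rw [e1, abs_div, abs_of_pos hpos, div_le_iff₀ hpos]
      exact h1
    rw [hBdef, highPart, coeff_mk, if_neg hj]
    calc _ ≤ _ := abs_sub_le _ ((((n - l : ℕ) : ℝ) / n) ^ (-β)) _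
      _ ≤ η / 2 + η / 2 := add_le_add h3 h2
      _ = η := add_halves η
  rw [Real.dist_eq, mul_comm, coeff_mul_range, sum_div]
  have hterm : ∀ l, coeff l (A ^ n) * coeff (n - l) B / coeff n H =
      coeff l (A ^ n) * (coeff (n - l) B / coeff n H) := fun l => mul_div_assoc _ _ _
  simp only [hterm]
  have hrew : ∑ l ∈ range (n + 1), coeff l (A ^ n) * (coeff (n - l) B / coeff n H) - y =
      ∑ l ∈ N, coeff l (A ^ n) * (coeff (n - l) B / coeff n H - y) +
      ∑ l ∈ F, coeff l (A ^ n) * (coeff (n - l) B / coeff n H) -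
      y * (1 - ∑ l ∈ N, coeff l (A ^ n)) := by
    rw [hsplit]
    simp only [mul_sub, sum_sub_distrib, ← sum_mul]
    ring
  have e1 : |∑ l ∈ N, coeff l (A ^ n) * (coeff (n - l) B / coeff n H - y)| ≤ η := by
    calc _ ≤ ∑ l ∈ N, |coeff l (A ^ n) * (coeff (n - l) B / coeff n H - y)| :=
          abs_sum_le_sum_abs _ _
      _ ≤ ∑ l ∈ N, coeff l (A ^ n) * η := by
          refine Finset.sum_le_sum fun l hl => ?_
          rw [abs_mul, abs_of_nonneg (hAp l)]
          exact mul_le_mul_of_nonneg_left (hNclose l hl) (hAp l)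
      _ = (∑ l ∈ N, coeff l (A ^ n)) * η := by rw [sum_mul]
      _ ≤ 1 * η := by gcongr; exact htot N
      _ = η := one_mul η
  have e2 : ∑ l ∈ F, coeff l (A ^ n) * (coeff (n - l) B / coeff n H) ≤ η * D := by
    calc _ ≤ ∑ l ∈ F, coeff l (A ^ n) * D :=
          Finset.sum_le_sum fun l _ => mul_le_mul_of_nonneg_left (hBle _) (hAp l)
      _ = (∑ l ∈ F, coeff l (A ^ n)) * D := by rw [sum_mul]
      _ ≤ _ := by gcongr
  have e3 : 0 ≤ ∑ l ∈ F, coeff l (A ^ n) * (coeff (n - l) B / coeff n H) :=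
    Finset.sum_nonneg fun l _ => mul_nonneg (hAp l) (div_nonneg (hB0 _) hpos.le)
  have e4 : y * (1 - ∑ l ∈ N, coeff l (A ^ n)) ≤ y * η := by
    gcongr
    linarith
  have e5 : 0 ≤ y * (1 - ∑ l ∈ N, coeff l (A ^ n)) :=
    mul_nonneg hy0.le (by linarith [htot N])
  rw [hrew]
  obtain ⟨e6, e7⟩ := abs_le.1 e1
  have hDη : 0 ≤ η * D := by positivity
  rw [abs_lt]
  constructor <;> nlinarith

/-- The one big jump principle, in local form, for sums of nonnegative integer random variables
with a regularly varying distribution. -/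
theorem tendsto_coeff_pow_div (hH0 : ∀ n, 0 ≤ coeff n H)
    (hHs : HasSum (fun n => coeff n H) 1) (hHm : HasSum (fun n : ℕ => (n : ℝ) * coeff n H) m)
    (hm1 : m < 1) {β : ℝ} (hβ : 2 < β) (hreg : RegVar (fun n => coeff n H) β) :
    Tendsto (fun n : ℕ => coeff n (H ^ (n + 1)) / (((n : ℝ) + 1) * coeff n H)) atTop
      (𝓝 ((1 - m) ^ (-β))) := by
  have hθ0 : 0 < 1 - m := by linarith
  set a := (β - 2) / 2 with ha
  have ha0 : 0 < a := by rw [ha]; linarith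
  have hB := summable_rpow_mul hβ hreg (a := a) (by rw [ha]; linarith)
  -- Chosen so that the Chernoff exponent `C * (1 - m) / 2` at `ρ = 1` equals `β + 1`, beating
  -- `coeff n H` once the prefactor `n + 1` is counted.
  set C := 2 * (β + 1) / (1 - m) with hC
  have hC0 : 0 < C := by positivity
  set δ := min (a / (2 * C)) ((1 - m) / 2) with hδ
  have hδ0 : 0 < δ := by positivity
  have hCδ : C * δ < a := by
    have h1 : C * δ ≤ C * (a / (2 * C)) := by gcongr; exact min_le_left _ _
    have h2 : C * (a / (2 * C)) = a / 2 := by field_simp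
    linarith
  have h2 := tendsto_coeff_highPart_mul_pow hH0 hHs hHm hm1 (by linarith) hreg ha0 hB hC0 hδ0 hCδ
    (min_le_right _ _)
  have h1 : Tendsto (fun n : ℕ => coeff n (lowPart H (δ * n) ^ (n + 1)) /
      (((n : ℝ) + 1) * coeff n H)) atTop (𝓝 0) := by
    obtain ⟨c, hc0, hc⟩ := hreg.exists_rpow_le (by linarith) (b := β + 1) (by linarith)
    have hlim := tendsto_const_div_atTop_nhds_zero_nat (1 / c)
    refine squeeze_zero' ?_ ?_ hlim
    · filter_upwards [hreg.1] with n h3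
      exact div_nonneg (coeff_pow_nonneg (lowPart_nonneg hH0 _) _ _) (by positivity)
    · filter_upwards [hc, hreg.1, eventually_gt_atTop 0,
        eventually_sum_lowPart_pow_le hH0 hHs hHm ha0 hB hC0 hCδ hm1] with n h3 h4 h5 h6
      have hn0 : (0 : ℝ) < n := by exact_mod_cast h5
      have h7 := h6 (n + 1) le_rfl {n} (by simp)
      rw [sum_singleton] at h7
      have e1 : C * (1 - m) / 2 = β + 1 := by rw [hC]; field_simp
      rw [e1] at h7
      rw [div_le_div_iff₀ (by positivity) hn0, div_mul_eq_mul_div, one_mul, le_div_iff₀ hc0]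
      calc _ ≤ (n : ℝ) ^ (-(β + 1)) * n * c := by gcongr
        _ = n * (c * (n : ℝ) ^ (-(β + 1))) := by ring
        _ ≤ n * coeff n H := by gcongr
        _ ≤ _ := by gcongr; linarith
  obtain ⟨D, hD0, hD⟩ := hreg.exists_le_mul (by linarith) hδ0
  -- Two or more large steps: one costs `D * coeff n H` pointwise, another the tail mass `t`, with
  -- multiplicity at most `(n + 1) ^ 2`. Relative to the main term this is `D * (n + 1) * t → 0`.
  have h3 : Tendsto (fun n : ℕ => (coeff n (H ^ (n + 1)) - coeff n (lowPart H (δ * n) ^ (n + 1)) -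
      ((n : ℝ) + 1) * coeff n (highPart H (δ * n) * lowPart H (δ * n) ^ n)) /
      (((n : ℝ) + 1) * coeff n H)) atTop (𝓝 0) := by
    have hlim := (tendsto_mul_tsum_highPart hH0 hHs hHm hδ0).const_mul D
    rw [mul_zero] at hlim
    have hQ : ∀ n : ℕ, ∃ Q : ℝ⟦X⟧, (∀ k, 0 ≤ coeff k Q) ∧
        (∃ q : ℝ, q ≤ ((n : ℝ) + 1) ^ 2 ∧ HasSum (fun k => coeff k Q) q) ∧
        coeff n (H ^ (n + 1)) - coeff n (lowPart H (δ * n) ^ (n + 1)) -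
        ((n : ℝ) + 1) * coeff n (highPart H (δ * n) * lowPart H (δ * n) ^ n) =
        coeff n (highPart H (δ * n) * (highPart H (δ * n) * Q)) := by
      intro n
      have ht0 : 0 ≤ ∑' j, coeff j (highPart H (δ * n)) := tsum_nonneg fun j => highPart_nonneg hH0 _ _
      obtain ⟨Q, e1, e2, e3⟩ := pow_succ_eq_add_sq_mul (lowPart_add_highPart H (δ * n))
        (lowPart_nonneg hH0 _) hH0 (hasSum_lowPart hH0 hHs (δ * n)) (by linarith) hHs n
      refine ⟨Q, e2, e3, ?_⟩
      have e4 := congrArg (coeff n) e1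
      rw [(coeff n).map_add, (coeff n).map_add,
        show (n + 1 : ℝ⟦X⟧) = PowerSeries.C ((n : ℝ) + 1) by simp, coeff_C_mul] at e4
      linarith
    choose Q hQ0 hQs hQe using hQ
    refine squeeze_zero' ?_ ?_ hlim
    · filter_upwards [hreg.1] with n h4
      rw [hQe]
      refine div_nonneg ?_ (by positivity)
      exact coeff_mul_nonneg (highPart_nonneg hH0 _)
        (coeff_mul_nonneg (highPart_nonneg hH0 _) (hQ0 n)) n
    · filter_upwards [hreg.1, hD] with n h4 h5
      rw [hQe]
      obtain ⟨q, hq1, hq2⟩ := hQs n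
      set t := ∑' j, coeff j (highPart H (δ * n)) with ht
      have ht0 : 0 ≤ t := tsum_nonneg fun j => highPart_nonneg hH0 _ _
      have hle : ∀ j, coeff j (highPart H (δ * n)) ≤ D * coeff n H := by
        intro j
        rw [highPart, coeff_mk]
        split_ifs with hj
        · positivity
        · exact h5 j (not_le.1 hj).le
      have h6 := coeff_mul_le (A := highPart H (δ * n)) (B := highPart H (δ * n) * Q n)
        (coeff_mul_nonneg (highPart_nonneg hH0 _) (hQ0 n)) (by positivity) hle
        (hasSum_coeff_mul (highPart_nonneg hH0 _) (hQ0 n) (summable_highPart hH0 hHs _).hasSum hq2) n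
      rw [div_le_iff₀ (by positivity)]
      calc _ ≤ _ := h6
        _ ≤ D * coeff n H * (t * ((n : ℝ) + 1) ^ 2) := by gcongr
        _ = _ := by ring
  have h4 := (h1.add h2).add h3
  rw [zero_add, add_zero] at h4
  refine h4.congr' ?_
  filter_upwards [hreg.1] with n h5
  have hn0 : (0 : ℝ) < n + 1 := by positivity
  field_simp
  ring

end BigJump
end PowerSeries

/-! ### Assembling the asymptotics of the number of leaves -/

/-- A probability distribution on `ℕ` with mean less than `1` charges `0`. -/
theorem zero_lt_of_mean_lt_one {p : ℕ → ℝ} (hp_nonneg : ∀ i, 0 ≤ p i) (hp_sum : HasSum p 1) {κ : ℝ}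
    (hκ : HasSum (fun i : ℕ => (i : ℝ) * p i) κ) (hκ_lt : κ < 1) : 0 < p 0 := by
  have h1 : HasSum (fun i => p i - if i = 0 then p 0 else 0) (1 - p 0) :=
    hp_sum.sub (hasSum_ite_eq 0 (p 0))
  have h2 : 1 - p 0 ≤ κ := by
    refine hasSum_le (fun i => ?_) h1 hκ
    rcases i with _ | i
    · simp
    · have := hp_nonneg (i + 1)
      simp only [Nat.add_eq_zero_iff, one_ne_zero, and_false, if_false, sub_zero]
      refine le_mul_of_one_le_left this ?_
      push_cast
      linarith [(Nat.cast_nonneg i : (0 : ℝ) ≤ i)]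
  linarith

namespace PowerSeries

/-- The functional equation of a generating function, from its coefficients. -/
theorem eq_C_mul_X_add_subst {p : ℕ → ℝ} {F : ℝ⟦X⟧} (hF0 : constantCoeff F = 0)
    (h : ∀ n, HasSum (fun i : ℕ => if i = 0 then (if n = 1 then p 0 else 0) else
      p i * coeff n (F ^ i)) (coeff n F)) :
    F = C (p 0) * X + (X * mk fun i => p (i + 1)).subst F := by
  ext n
  have h1 : HasSum (fun i : ℕ => if i = 0 then (if n = 1 then p 0 else 0) else
      p i * coeff n (F ^ i)) (∑ i ∈ range (n + 1),
        if i = 0 then (if n = 1 then p 0 else 0) else p i * coeff n (F ^ i)) := by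
    refine hasSum_sum_of_ne_finset_zero fun i hi => ?_
    have hi' : n < i := by
      by_contra hcon
      exact hi (mem_range.2 (by omega))
    rw [if_neg (by omega), coeff_pow_eq_zero_of_lt hF0 hi', mul_zero]
  rw [(h n).unique h1, (coeff n).map_add, coeff_subst_eq_sum hF0, sum_range_succ', sum_range_succ',
    coeff_C_mul, coeff_X]
  simp only [Nat.add_eq_zero_iff, one_ne_zero, and_false, if_false, if_true, coeff_succ_X_mul,
    coeff_mk, coeff_zero_X_mul, zero_mul, add_zero, mul_ite, mul_one, mul_zero]
  ring

theorem exists_mul_one_sub_eq_C {G : ℝ⟦X⟧} (c : ℝ) (hG : coeff 0 G ≠ 1) :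
    ∃ H : ℝ⟦X⟧, H * (1 - G) = C c := by
  refine ⟨C c * (1 - G)⁻¹, ?_⟩
  rw [mul_assoc, PowerSeries.inv_mul_cancel, mul_one]
  rw [map_sub, map_one, ← coeff_zero_eq_constantCoeff_apply]
  exact sub_ne_zero.2 hG.symm

end PowerSeries

theorem lemmaA1 {Ω : Type*} [MeasurableSpace Ω]
    (P : MeasureTheory.Measure Ω) [MeasureTheory.IsProbabilityMeasure P]
    -- the offspring distribution, with mean `κ < 1`, regularly varying with exponent `-β`
    (p : ℕ → ℝ) (hp_nonneg : ∀ i, 0 ≤ p i) (hp_sum : HasSum p 1)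
    (β : ℝ) (hβ : 2 < β)
    (L : ℝ → ℝ) (hL : IsSlowlyVarying L)
    (hpL : ∀ i : ℕ, 1 ≤ i → p i = L i * (i : ℝ) ^ (-β))
    (κ : ℝ) (hκ : HasSum (fun i : ℕ => (i : ℝ) * p i) κ) (hκ_lt : κ < 1)
    -- the i.i.d. offspring numbers that generate the Galton-Watson tree
    (ξ : List ℕ → Ω → ℕ) (hξ_meas : ∀ v, Measurable (ξ v))
    (hξ_indep : ProbabilityTheory.iIndepFun ξ P)
    (hξ_law : ∀ (v : List ℕ) (i : ℕ), P {ω | ξ v ω = i} = ENNReal.ofReal (p i)) :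
    Asymptotics.IsEquivalent Filter.atTop
      (fun n : ℕ => P.real {ω | numLeaves (plantedTree (fun v => ξ v ω)) = (n : ℕ∞)})
      (fun n : ℕ => p 0 ^ (β - 1) * (1 - κ) ^ (-β) * (L n * (n : ℝ) ^ (-β))) := by
  have hp0 : 0 < p 0 := zero_lt_of_mean_lt_one hp_nonneg hp_sum hκ hκ_lt
  set f : ℕ → ℝ := fun n => P.real {ω | leafCount (fun v => ξ v ω) = (n : ℕ∞)} with hf
  change Asymptotics.IsEquivalent atTop f _
  set F : PowerSeries ℝ := PowerSeries.mk f with hF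
  set G : PowerSeries ℝ := PowerSeries.mk fun i => p (i + 1) with hG
  have hF0 : PowerSeries.constantCoeff F = 0 := by
    rw [← PowerSeries.coeff_zero_eq_constantCoeff_apply, hF, PowerSeries.coeff_mk]
    exact measureReal_leafCount_eq_zero inferInstance hξ_meas hξ_indep hp_nonneg hp0 hp_sum hξ_law
  have hFG : F = PowerSeries.C (p 0) * PowerSeries.X + (PowerSeries.X * G).subst F := by
    refine PowerSeries.eq_C_mul_X_add_subst hF0 fun n => ?_
    have := hasSum_measureReal_leafCount inferInstance hξ_meas hξ_indep hp_nonneg hξ_law n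
    rw [hF, PowerSeries.coeff_mk]
    exact this
  have hG0 : ∀ n, 0 ≤ PowerSeries.coeff n G := fun n => by
    rw [hG, PowerSeries.coeff_mk]; exact hp_nonneg _
  have hGs : HasSum (fun n => PowerSeries.coeff n G) (1 - p 0) := by
    simp only [hG, PowerSeries.coeff_mk]
    have := (hasSum_nat_add_iff' 1).2 hp_sum
    simpa using this
  have hGm : HasSum (fun n : ℕ => (n : ℝ) * PowerSeries.coeff n G) (κ - (1 - p 0)) := by
    have h1 : HasSum (fun n : ℕ => ((n + 1 : ℕ) : ℝ) * p (n + 1)) κ := by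
      have := (hasSum_nat_add_iff' 1).2 hκ
      simpa using this
    have h2 := h1.sub hGs
    have e : (fun n : ℕ => ((n + 1 : ℕ) : ℝ) * p (n + 1) - PowerSeries.coeff n G) =
        fun n : ℕ => (n : ℝ) * PowerSeries.coeff n G := by
      funext n
      rw [hG, PowerSeries.coeff_mk]
      push_cast
      ring
    rwa [e] at h2
  have hβ0 : 0 < β := by linarith
  have hpreg : RegVar p β := hL.regVar hβ0 hpL
  have hGreg : RegVar (fun n => PowerSeries.coeff n G) β := by
    simp only [hG, PowerSeries.coeff_mk]
    exact hpreg.succ hβ0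
  have hG1 : PowerSeries.coeff 0 G ≤ 1 - p 0 := le_hasSum hGs 0 fun i _ => hG0 i
  obtain ⟨H, hH⟩ := PowerSeries.exists_mul_one_sub_eq_C (p 0) (by linarith : PowerSeries.coeff 0 G ≠ 1)
  have hlag := PowerSeries.lagrange_inversion hF0 (PowerSeries.eq_X_mul_subst hp0.ne' hF0 hFG hH)
  have hratio := PowerSeries.renewal_tendsto hp0 hG0 hGs hH (by linarith) hGreg hGm.summable
  have hHreg := hGreg.of_tendsto_div hβ0 (one_div_pos.2 hp0) hratio
  have hHm := PowerSeries.renewal_hasSum_mean hp0 hG0 hGs hH hGm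
  -- Subcriticality `κ < 1` is exactly what puts the mean of `H` below `1`, the regime of the big
  -- jump.
  have hm : 1 - (κ - (1 - p 0)) / p 0 = (1 - κ) / p 0 := by field_simp; ring
  have hκ0 : 0 < 1 - κ := by linarith
  have hm1 : (κ - (1 - p 0)) / p 0 < 1 := by
    have : 0 < (1 - κ) / p 0 := by positivity
    linarith
  have hjump := PowerSeries.tendsto_coeff_pow_div (PowerSeries.renewal_nonneg hp0 hG0 hGs hH)
    (PowerSeries.renewal_hasSum hp0 hG0 hGs hH) hHm hm1 hβ hHreg
  rw [hm] at hjump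
  have hconst : ((1 - κ) / p 0) ^ (-β) * (1 / p 0) = p 0 ^ (β - 1) * (1 - κ) ^ (-β) := by
    rw [Real.div_rpow hκ0.le hp0.le, Real.rpow_neg hp0.le, Real.rpow_sub hp0, Real.rpow_one]
    field_simp
  set c := p 0 ^ (β - 1) * (1 - κ) ^ (-β) with hc
  have hc0 : 0 < c := by positivity
  have hlim : Tendsto (fun n => f n / p n) atTop (𝓝 c) := by
    -- The shift matches both sides: Lagrange inversion gives `f (n + 1)` from degree `n` of `H ^ (n
    -- + 1)`, and `coeff n G` is `p (n + 1)`.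
    rw [← tendsto_add_atTop_iff_nat 1, ← hconst]
    refine (hjump.mul hratio).congr' ?_
    filter_upwards [hHreg.1, hGreg.1] with n h1 h2
    have h3 := hlag n
    rw [hF, PowerSeries.coeff_mk] at h3
    have h4 : PowerSeries.coeff n G = p (n + 1) := by rw [hG, PowerSeries.coeff_mk]
    rw [h4] at h2 ⊢
    rw [← h3]
    have hn : (0 : ℝ) < (n : ℝ) + 1 := by positivity
    field_simp
  have hpe : ∀ᶠ n : ℕ in atTop, L n * (n : ℝ) ^ (-β) = p n := by
    filter_upwards [eventually_ge_atTop 1] with n hn using (hpL n hn).symm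
  rw [Asymptotics.isEquivalent_iff_tendsto_one]
  · have h1 := hlim.div_const c
    rw [div_self hc0.ne'] at h1
    refine h1.congr' ?_
    filter_upwards [hpe] with n hn
    rw [Pi.div_apply, hn, div_div, mul_comm c]
  · filter_upwards [hpe, hpreg.1] with n hn hn2
    rw [hn]
    positivity
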